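/- Let $p$ be a prime, $n\ge 1$ an integer, and $GF(p^n)$ the field with $p^n$ elements. For a ring $R$ and $a\in R$ let $\langle a\rangle=\{q(a) : q\in\mathbb Z[x],\ q(0)=0\}$ be the (not necessarily unital) subring generated by $a$, and write $a\sim b$ if $\langle a\rangle=\langle b\rangle$. The compressed commuting graph $\Lambda(R)$ is the undirected graph, with loops allowed, whose vertices are the equivalence classes $[a]$ of elements of $R$ under $\sim$, with $[a]$ and $[b]$ adjacent if and only if $ab=ba$. Let $K^\circ_m$ be the complete graph on $m$ vertices with all the loops; $G\cup H$ is the disjoint union, $tG$ the disjoint union of $t$ copies of $G$, and $G\vee H$ the join (the disjoint union together with all edges between $G$ and $H$). Let $d(n)$ be the number and $\sigma(n)$ the sum of the positive divisors of $n$, and put $$a'(n)=\begin{cases} d(n)^2+d(n)+\sigma(n)-2, & p=2 \text{ and } n \text{ even},\\ d(n)^2+d(n)+\sigma(n)-1, & p=2 \text{ and } n \text{ odd},\\ d(n)^2+d(n)+\sigma(n), & p>2,\end{cases}$$ $$b'(n)=\frac{p^n-1}{p-1}+\sum_{k\mid n}\frac{p^n-1}{p^k-1},\qquad c(n)=d(2n)-d(n).$$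 Then the compressed commuting graph of the ring $\mathcal M_2(GF(p^n))$ of $2\times 2$ matrices over $GF(p^n)$ is $$\Lambda(\mathcal M_2(GF(p^n)))\cong K^\circ_{d(n)+1}\vee\Big(\tfrac{p^{2n}+p^n}{2}K^\circ_{a'(n)}\cup(p^n+1)K^\circ_{b'(n)}\cup\tfrac{p^{2n}-p^n}{2}K^\circ_{c(n)}\Big).$$ -/

import Mathlib

/-- An undirected graph without multiple edges in which loops are allowed. -/
@[ext]
structure LoopGraph (V : Type*) where
  Adj : V → V → Prop
  symm : ∀ u v, Adj u v → Adj v u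

namespace LoopGraph

/-- Isomorphisms of graphs: bijections on vertices that preserve and reflect adjacency. -/
abbrev Iso {V W : Type*} (G : LoopGraph V) (H : LoopGraph W) :=
  G.Adj ≃r H.Adj

/-- `K°_m`: the complete graph on `m` vertices together with all the loops. -/
def completeLoop (m : ℕ) : LoopGraph (Fin m) where
  Adj _ _ := True
  symm _ _ _ := trivial

/-- `G ∪ H`: the disjoint union. -/
def disjointUnion {V W : Type*} (G : LoopGraph V) (H : LoopGraph W) : LoopGraph (V ⊕ W) where
  Adj
    | Sum.inl u, Sum.inl v => G.Adj u v
    | Sum.inr u, Sum.inr v => H.Adj u v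
    | _, _ => False
  symm
    | Sum.inl u, Sum.inl v => G.symm u v
    | Sum.inr u, Sum.inr v => H.symm u v
    | Sum.inl _, Sum.inr _ => id
    | Sum.inr _, Sum.inl _ => id

/-- `G ∨ H`: the join, i.e. the disjoint union together with all edges between `G` and `H`. -/
def join {V W : Type*} (G : LoopGraph V) (H : LoopGraph W) : LoopGraph (V ⊕ W) where
  Adj
    | Sum.inl u, Sum.inl v => G.Adj u v
    | Sum.inr u, Sum.inr v => H.Adj u v
    | _, _ => True
  symm
    | Sum.inl u, Sum.inl v => G.symm u v
    | Sum.inr u, Sum.inr v => H.symm u v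
    | Sum.inl _, Sum.inr _ => id
    | Sum.inr _, Sum.inl _ => id

/-- `t G`: the disjoint union of `t` copies of `G`. -/
def copies {V : Type*} (t : ℕ) (G : LoopGraph V) : LoopGraph (Fin t × V) where
  Adj x y := x.1 = y.1 ∧ G.Adj x.2 y.2
  symm _ _ h := ⟨h.1.symm, G.symm _ _ h.2⟩

end LoopGraph

namespace CompressedCommuting

section Graph

variable (R : Type*) [NonUnitalRing R]

/-- `a ∼ b` if and only if `a` and `b` generate the same (not necessarily unital) subring. -/
def genSetoid : Setoid R where
  r a b := NonUnitalSubring.closure {a} = NonUnitalSubring.closure {b}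
  iseqv := ⟨fun _ => rfl, fun h => h.symm, fun h k => h.trans k⟩

variable {R}

theorem commute_of_mem_closure {a b a' b' : R} (ha : a' ∈ NonUnitalSubring.closure {a})
    (hb : b' ∈ NonUnitalSubring.closure {b}) (h : a * b = b * a) : a' * b' = b' * a' := by
  have h1 : NonUnitalSubring.closure {a} ≤ NonUnitalSubring.centralizer {b} := by
    rw [NonUnitalSubring.closure_le]
    rintro x rfl
    refine NonUnitalSubring.mem_centralizer_iff.2 fun y hy => ?_
    rw [Set.mem_singleton_iff.1 hy]
    exact h.symm
  have h2 : NonUnitalSubring.closure {b} ≤ NonUnitalSubring.centralizer {a'} := by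
    rw [NonUnitalSubring.closure_le]
    rintro x rfl
    have := NonUnitalSubring.mem_centralizer_iff.1 (h1 ha) x rfl
    refine NonUnitalSubring.mem_centralizer_iff.2 fun y hy => ?_
    rw [Set.mem_singleton_iff.1 hy]
    exact this.symm
  exact NonUnitalSubring.mem_centralizer_iff.1 (h2 hb) a' rfl

theorem commute_congr {a b a' b' : R} (ha : genSetoid R a a') (hb : genSetoid R b b') :
    (a * b = b * a) = (a' * b' = b' * a') := by
  have ha : NonUnitalSubring.closure {a} = NonUnitalSubring.closure {a'} := ha
  have hb : NonUnitalSubring.closure {b} = NonUnitalSubring.closure {b'} := hb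
  refine propext ⟨commute_of_mem_closure ?_ ?_, commute_of_mem_closure ?_ ?_⟩
  · rw [ha]; exact NonUnitalSubring.subset_closure rfl
  · rw [hb]; exact NonUnitalSubring.subset_closure rfl
  · rw [← ha]; exact NonUnitalSubring.subset_closure rfl
  · rw [← hb]; exact NonUnitalSubring.subset_closure rfl

variable (R)

/-- `Λ(R)`: the compressed commuting graph of a (possibly nonunital) ring `R`. Its vertices are
the classes of elements generating the same subring; `[a]` and `[b]` are adjacent if and only if
`a * b = b * a`. -/
def graph : LoopGraph (Quotient (genSetoid R)) where
  Adj := Quotient.lift₂ (fun a b : R => a * b = b * a) fun _ _ _ _ h k => commute_congr h k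
  symm := by
    rintro ⟨a⟩ ⟨b⟩ h
    exact Eq.symm h

end Graph

/-- `d(n)`: the number of positive divisors of `n`. -/
def d (n : ℕ) : ℕ := n.divisors.card

/-- `σ(n)`: the sum of the positive divisors of `n`. -/
def sigma (n : ℕ) : ℕ := ∑ k ∈ n.divisors, k

/-- `a'(n)`. The truncated subtractions are genuine ones for `n ≥ 1`. -/
def a' (p n : ℕ) : ℕ :=
  if p = 2 then
    if Even n then d n ^ 2 + d n + sigma n - 2 else d n ^ 2 + d n + sigma n - 1
  else d n ^ 2 + d n + sigma n

/-- `b'(n)`. The divisions are exact for `p ≥ 2` and `n ≥ 1`. -/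
def b' (p n : ℕ) : ℕ :=
  (p ^ n - 1) / (p - 1) + ∑ k ∈ n.divisors, (p ^ n - 1) / (p ^ k - 1)

/-- `c(n)`. -/
def c (n : ℕ) : ℕ := d (2 * n) - d n

end CompressedCommuting

set_option linter.unusedSectionVars false

/-! The centralizer of a nonscalar `2 × 2` matrix `a` is `F + F a`, so two nonscalar matrices
commute exactly when their centralizers coincide (`commute_iff_centralizer_eq`), while scalars
commute with everything. Hence the graph is the join of the complete graph on the scalar classes
with a disjoint union of complete graphs, one for each centralizer of a nonscalar matrix.
`LoopGraph.nonempty_iso_of_labelling`, with the centralizer as label, reduces the theorem to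
counting.

Put `q = p ^ n`. Such a centralizer is a copy of `F × F` (it contains a proper idempotent), of
`F[ε]` (a nonzero nilpotent), or of the field with `q ^ 2` elements (no eigenvalue in `F`). There
are `q ^ 2 + q + 1` centralizers; `(q ^ 2 + q) / 2` are of the first type, `q + 1` of the second,
and subtraction gives the third.

The vertices belonging to one centralizer are the subrings generated by one nonscalar element. In a
finite field a nonzero `x` generates the fixed field of `Frob ^ k`, where `k` is its Frobenius
period, so nonzero subfields correspond to divisors; this gives `d(n) + 1` for the scalars and
`c(n)` for the quadratic field. In `F × F` with nonzero coordinates, `(x, y)` generates the graph of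
a power of Frobenius on a subfield if `y` is conjugate to `x`, and otherwise the product of two
subfields. The corrections in `a'` come from `p = 2`, where all elements of period `1`, respectively
`2`, are conjugate apart from `0`. In `F[ε]`, `x + y ε` generates `k + k y ε` if `x ≠ 0` generates
the subfield `k`, and `GF(p) y ε` if `x = 0`; counting lines over subfields gives `b'`. -/

theorem Set.ncard_image_eq_of_forall_eq_iff {α β γ : Type*} {P : Set α} (f : α → β) (g : α → γ)
    (h : ∀ s ∈ P, ∀ t ∈ P, f s = f t ↔ g s = g t) : (f '' P).ncard = (g '' P).ncard := by
  classical
  refine Set.ncard_congr (fun b hb => g hb.choose) (fun b hb => ⟨_, hb.choose_spec.1, rfl⟩) ?_ ?_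
  · intro b b' hb hb' hg
    have := (h _ hb.choose_spec.1 _ hb'.choose_spec.1).2 hg
    rw [← hb.choose_spec.2, ← hb'.choose_spec.2, this]
  · rintro _ ⟨s, hs, rfl⟩
    refine ⟨f s, ⟨s, hs, rfl⟩, ?_⟩
    have hb : ∃ a, a ∈ P ∧ f a = f s := ⟨s, hs, rfl⟩
    exact (h _ hb.choose_spec.1 _ hs).1 hb.choose_spec.2

/-! ### Nonunital subrings generated by one element -/

section PowMem

theorem NonUnitalSubring.pow_mem_of_pos {R : Type*} [Ring R] (B : NonUnitalSubring R) {x : R}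
    (hx : x ∈ B) {m : ℕ} (hm : 0 < m) : x ^ m ∈ B := by
  induction m, hm using Nat.le_induction with
  | base => simpa using hx
  | succ k hk ih => rw [pow_succ]; exact B.mul_mem ih hx

theorem NonUnitalSubring.coe_closure_singleton_map {R S : Type*} [Ring R] [Ring S] (f : R →ₙ+* S)
    (x : R) : (NonUnitalSubring.closure {f x} : Set S)
      = f '' (NonUnitalSubring.closure {x} : Set R) := by
  have := NonUnitalRingHom.map_closure f {x}
  rw [Set.image_singleton] at this
  rw [← this, NonUnitalSubring.coe_map]

end PowMem

/-! ### Subfields of a finite field and Frobenius periods -/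

section FiniteField

variable (p : ℕ) [Fact p.Prime] {K : Type*} [Field K] [Finite K] [CharP K p]

/-- The fixed points of the `k`-th power of the Frobenius. -/
def frobFixed (K : Type*) [Field K] (k : ℕ) : Set K := {t | t ^ p ^ k = t}

/-- The period of `x` under the Frobenius. -/
noncomputable def frobPeriod (x : K) : ℕ := Function.minimalPeriod (frobenius K p) x

theorem pow_prime_pow_eq_self_iff {x : K} {j : ℕ} : x ^ p ^ j = x ↔ frobPeriod p x ∣ j := by
  rw [frobPeriod, ← Function.isPeriodicPt_iff_minimalPeriod_dvd, Function.IsPeriodicPt,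
    Function.IsFixedPt, iterate_frobenius]

theorem pow_prime_pow_eq_self {n : ℕ} (hK : Nat.card K = p ^ n) (x : K) : x ^ p ^ n = x := by
  have := Fintype.ofFinite K
  rw [← hK, Nat.card_eq_fintype_card]
  exact FiniteField.pow_card x

theorem frobPeriod_dvd {n : ℕ} (hK : Nat.card K = p ^ n) (x : K) : frobPeriod p x ∣ n :=
  (pow_prime_pow_eq_self_iff p).1 (pow_prime_pow_eq_self p hK x)

theorem exists_card_eq_prime_pow (K : Type*) [Field K] [Finite K] [CharP K p] :
    ∃ n, 0 < n ∧ Nat.card K = p ^ n := by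
  have := Fintype.ofFinite K
  obtain ⟨n, _, hn⟩ := FiniteField.card K p
  exact ⟨n, n.pos, by rw [Nat.card_eq_fintype_card, hn]⟩

theorem frobPeriod_pos (x : K) : 0 < frobPeriod p x := by
  obtain ⟨n, hn, hK⟩ := exists_card_eq_prime_pow p K
  exact Nat.pos_of_dvd_of_pos (frobPeriod_dvd p hK x) hn

theorem ncard_frobFixed_le {k : ℕ} (hk : 0 < k) : (frobFixed p K k).ncard ≤ p ^ k := by
  classical
  have hp := (Fact.out : p.Prime).one_lt
  have h0 : (Polynomial.X ^ p ^ k - Polynomial.X : Polynomial K) ≠ 0 :=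
    FiniteField.X_pow_card_pow_sub_X_ne_zero K hk.ne' hp
  have : frobFixed p K k ⊆
      ((Polynomial.X ^ p ^ k - Polynomial.X : Polynomial K).roots.toFinset : Set K) := by
    intro t ht
    have ht : t ^ p ^ k = t := ht
    simp [Polynomial.mem_roots h0, ht]
  refine (Set.ncard_le_ncard this).trans ?_
  rw [Set.ncard_coe_finset]
  refine (Multiset.toFinset_card_le _).trans ((Polynomial.card_roots' _).trans ?_)
  rw [FiniteField.X_pow_card_pow_sub_X_natDegree_eq K hk.ne' hp]

/-- By Fermat, `1` is the positive power `x ^ (q - 1)`, so a nonunital subring with a nonzero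
element is unital. -/
theorem one_mem_closure_singleton {x : K} (hx : x ≠ 0) :
    (1 : K) ∈ NonUnitalSubring.closure {x} := by
  have := Fintype.ofFinite K
  have h1 : x ^ (Fintype.card K - 1) = 1 := FiniteField.pow_card_sub_one_eq_one x hx
  have h2 := NonUnitalSubring.pow_mem_of_pos (NonUnitalSubring.closure {x})
    (NonUnitalSubring.mem_closure_of_mem (Set.mem_singleton x))
    (Nat.sub_pos_of_lt (Fintype.one_lt_card (α := K)))
  rwa [h1] at h2

/-- Nonzero elements of a finite field generate the fixed field of a power of the Frobenius. -/
theorem coe_closure_singleton_and_ncard {x : K} (hx : x ≠ 0) :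
    (NonUnitalSubring.closure {x} : Set K) = frobFixed p K (frobPeriod p x) ∧
      (frobFixed p K (frobPeriod p x)).ncard = p ^ frobPeriod p x := by
  have hp := (Fact.out : p.Prime).one_lt
  set B := NonUnitalSubring.closure {x} with hB
  have hxB : x ∈ B := NonUnitalSubring.subset_closure rfl
  let B' : Subring K := { B with one_mem' := one_mem_closure_singleton hx }
  obtain ⟨n, hn, hK⟩ := exists_card_eq_prime_pow p K
  have hcard : Nat.card B' ∣ p ^ n := hK ▸ AddSubgroup.card_addSubgroup_dvd_card B'.toAddSubgroup
  obtain ⟨j, -, hj⟩ := (Nat.dvd_prime_pow Fact.out).1 hcard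
  have hfix : (B : Set K) ⊆ frobFixed p K j := by
    intro t ht
    have := Fintype.ofFinite B'
    classical
    -- A finite domain is a field, so its elements are fixed by raising to its cardinality `p ^ j`.
    let _ : Field B' := Fintype.fieldOfDomain B'
    have h := FiniteField.pow_card (⟨t, ht⟩ : B')
    rw [← Nat.card_eq_fintype_card, hj] at h
    exact (SubmonoidClass.coe_pow (⟨t, ht⟩ : B') _).symm.trans (congrArg Subtype.val h)
  have hdvd : frobPeriod p x ∣ j := (pow_prime_pow_eq_self_iff p).1 (hfix hxB)
  have hle : (B : Set K) ⊆ frobFixed p K (frobPeriod p x) := by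
    have : B ≤ (RingHom.eqLocus (iterateFrobenius K p (frobPeriod p x))
        (RingHom.id K)).toNonUnitalSubring := by
      rw [hB, NonUnitalSubring.closure_le, Set.singleton_subset_iff]
      exact (pow_prime_pow_eq_self_iff p).2 dvd_rfl
    exact this
  -- Sandwich: `p ^ j = |B| ≤ |Fix| ≤ p ^ period ≤ p ^ j`. The last inequality uses that the period
  -- divides `j` and that `j ≠ 0`, because `B` contains `0` and `1`.
  have hjc : (B : Set K).ncard = p ^ j := by rw [← hj]; rfl
  have hle' := (Set.ncard_le_ncard hle)
  have hle2 := ncard_frobFixed_le p (K := K) (frobPeriod_pos p x)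
  have hj0 : j ≠ 0 := by
    rintro rfl
    have h2 : ({0, 1} : Set K) ⊆ B := by
      rintro t (rfl | rfl)
      · exact B.zero_mem
      · exact one_mem_closure_singleton hx
    have := Set.ncard_le_ncard h2
    rw [Set.ncard_pair zero_ne_one, hjc] at this
    simp at this
  have hjle := Nat.le_of_dvd (Nat.pos_of_ne_zero hj0) hdvd
  have hpow := Nat.pow_le_pow_right hp.le hjle
  have hn' : (frobFixed p K (frobPeriod p x)).ncard = p ^ frobPeriod p x := by
    apply le_antisymm hle2; omega
  exact ⟨Set.eq_of_subset_of_ncard_le hle (by omega), hn'⟩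

theorem coe_closure_singleton {x : K} (hx : x ≠ 0) :
    (NonUnitalSubring.closure {x} : Set K) = frobFixed p K (frobPeriod p x) :=
  (coe_closure_singleton_and_ncard p hx).1

theorem mem_frobFixed_frobPeriod (x : K) : x ∈ frobFixed p K (frobPeriod p x) :=
  (pow_prime_pow_eq_self_iff p).2 dvd_rfl

theorem zero_mem_frobFixed (k : ℕ) : (0 : K) ∈ frobFixed p K k :=
  zero_pow (pow_ne_zero _ (Fact.out : p.Prime).ne_zero)

theorem one_mem_frobFixed (k : ℕ) : (1 : K) ∈ frobFixed p K k := one_pow _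

/-- A unit of order `p ^ k - 1` for each `k ∣ n`. -/
theorem exists_orderOf_eq {n k : ℕ} (hn : 0 < n) (hK : Nat.card K = p ^ n) (hk : k ∣ n) :
    ∃ u : Kˣ, orderOf u = p ^ k - 1 := by
  obtain ⟨g, hg⟩ := IsCyclic.exists_ofOrder_eq_natCard (α := Kˣ)
  rw [Nat.card_units, hK] at hg
  have hd : p ^ k - 1 ∣ p ^ n - 1 := Nat.pow_sub_one_dvd_pow_sub_one p hk
  have hpos : 0 < p ^ n - 1 :=
    Nat.sub_pos_of_lt (Nat.one_lt_pow hn.ne' (Fact.out : p.Prime).one_lt)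
  -- A power of a generator of the cyclic group `Kˣ`; it generates the unit group of the subfield
  -- with `p ^ k` elements.
  refine ⟨g ^ ((p ^ n - 1) / (p ^ k - 1)), ?_⟩
  have hq : (p ^ n - 1) / (p ^ k - 1) ∣ p ^ n - 1 := Nat.div_dvd_of_dvd hd
  rw [orderOf_pow_of_dvd (Nat.div_pos (Nat.le_of_dvd hpos hd)
    (Nat.pos_of_dvd_of_pos hd hpos)).ne' (by rw [hg]; exact hq), hg]
  exact Nat.div_div_self hd hpos.ne'

theorem frobPeriod_eq_of_orderOf {u : Kˣ} {k : ℕ} (hk : 0 < k) (hu : orderOf u = p ^ k - 1) :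
    frobPeriod p (u : K) = k := by
  have hp := (Fact.out : p.Prime).one_lt
  have key : ∀ j, (u : K) ^ p ^ j = u ↔ p ^ k - 1 ∣ p ^ j - 1 := by
    intro j
    have h1 : 1 ≤ p ^ j := Nat.one_le_pow _ _ (by omega)
    rw [← hu, orderOf_dvd_iff_pow_eq_one, ← Units.val_pow_eq_pow_val, Units.val_inj]
    conv_lhs => rw [← Nat.sub_add_cancel h1, pow_succ]
    simp
  have h1 : frobPeriod p (u : K) ∣ k := (pow_prime_pow_eq_self_iff p).1 ((key k).2 dvd_rfl)
  have h2 := (key _).1 ((pow_prime_pow_eq_self_iff p (x := (u : K))).2 dvd_rfl)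
  have h3 := frobPeriod_pos p (u : K)
  have h4 : 1 < p ^ frobPeriod p (u : K) := Nat.one_lt_pow h3.ne' hp
  have h5 := Nat.le_of_dvd (by omega) h2
  have h6 : p ^ k ≤ p ^ frobPeriod p (u : K) := by omega
  exact le_antisymm (Nat.le_of_dvd hk h1) ((Nat.pow_le_pow_iff_right hp).1 h6)

theorem exists_frobPeriod_eq {n k : ℕ} (hn : 0 < n) (hK : Nat.card K = p ^ n) (hk : k ∣ n) :
    ∃ x : K, x ≠ 0 ∧ frobPeriod p x = k := by
  obtain ⟨u, hu⟩ := exists_orderOf_eq p hn hK hk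
  exact ⟨u, u.ne_zero, frobPeriod_eq_of_orderOf p (Nat.pos_of_dvd_of_pos hk hn) hu⟩

theorem ncard_frobFixed {n k : ℕ} (hn : 0 < n) (hK : Nat.card K = p ^ n) (hk : k ∣ n) :
    (frobFixed p K k).ncard = p ^ k := by
  obtain ⟨x, hx, rfl⟩ := exists_frobPeriod_eq p hn hK hk
  exact (coe_closure_singleton_and_ncard p hx).2

theorem frobFixed_injOn {n : ℕ} (hn : 0 < n) (hK : Nat.card K = p ^ n) :
    Set.InjOn (frobFixed p K) n.divisors := by
  intro k hk l hl h
  have h1 := ncard_frobFixed p hn hK (Nat.dvd_of_mem_divisors hk)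
  have h2 := ncard_frobFixed p hn hK (Nat.dvd_of_mem_divisors hl)
  rw [h, h2] at h1
  exact (Nat.pow_right_injective (Fact.out : p.Prime).two_le h1).symm

/-- Elements with the same minimal polynomial form a Galois orbit, and the Galois group over the
prime field is generated by Frobenius. -/
theorem minpoly_eq_iff_exists_pow {x y : K} [Algebra (ZMod p) K] :
    minpoly (ZMod p) x = minpoly (ZMod p) y ↔ ∃ i : ℕ, y = x ^ p ^ i := by
  rw [eq_comm, Normal.minpoly_eq_iff_mem_orbit]
  have key : ∀ i : ℕ, ((FiniteField.frobeniusAlgEquivOfAlgebraic (ZMod p) K) ^ i) • x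
      = x ^ p ^ i := by
    intro i
    rw [AlgEquiv.smul_def, AlgEquiv.coe_pow,
      FiniteField.coe_frobeniusAlgEquivOfAlgebraic_iterate, ZMod.card]
  constructor
  · rintro ⟨s, hs⟩
    obtain ⟨i, rfl⟩ := (FiniteField.bijective_frobeniusAlgEquivOfAlgebraic_pow (ZMod p) K).2 s
    exact ⟨i, by rw [← key]; exact hs.symm⟩
  · rintro ⟨i, rfl⟩
    exact ⟨FiniteField.frobeniusAlgEquivOfAlgebraic (ZMod p) K ^ i, key i⟩

/-- The classes in a finite field of elements satisfying a condition on the period. -/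
theorem image_closure_eq_image_frobFixed {n : ℕ} (hn : 0 < n) (hK : Nat.card K = p ^ n)
    (P : ℕ → Prop) :
    (fun x : K => (NonUnitalSubring.closure {x} : Set K)) '' {x | x ≠ 0 ∧ P (frobPeriod p x)}
      = frobFixed p K '' {k | k ∈ n.divisors ∧ P k} := by
  ext B
  constructor
  · rintro ⟨x, ⟨hx, hP⟩, rfl⟩
    exact ⟨_, ⟨Nat.mem_divisors.2 ⟨frobPeriod_dvd p hK x, hn.ne'⟩, hP⟩,
      (coe_closure_singleton p hx).symm⟩
  · rintro ⟨k, ⟨hk, hP⟩, rfl⟩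
    obtain ⟨x, hx, rfl⟩ := exists_frobPeriod_eq p hn hK (Nat.dvd_of_mem_divisors hk)
    exact ⟨x, ⟨hx, hP⟩, coe_closure_singleton p hx⟩

end FiniteField

theorem NonUnitalSubring.coe_closure_singleton_zero (R : Type*) [Ring R] :
    (NonUnitalSubring.closure {(0 : R)} : Set R) = {0} := by
  have : NonUnitalSubring.closure {(0 : R)} = ⊥ := by
    rw [eq_bot_iff, NonUnitalSubring.closure_le, Set.singleton_subset_iff]
    exact NonUnitalSubring.zero_mem _
  rw [this, NonUnitalSubring.coe_bot]

/-! ### Frobenius conjugacy and periods -/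

section Conjugates

variable (p : ℕ) [Fact p.Prime] {K : Type*} [Field K] [Finite K] [CharP K p]

theorem frobPeriod_pow_prime_pow (x : K) (i : ℕ) : frobPeriod p (x ^ p ^ i) = frobPeriod p x := by
  refine Nat.dvd_right_iff_eq.1 fun j => ?_
  rw [← pow_prime_pow_eq_self_iff, ← pow_prime_pow_eq_self_iff, pow_right_comm]
  exact (iterateFrobenius_inj K p i).eq_iff

theorem eq_pow_mod_frobPeriod (x : K) (i : ℕ) : x ^ p ^ (i % frobPeriod p x) = x ^ p ^ i := by
  have h : (x ^ p ^ (frobPeriod p x * (i / frobPeriod p x))) = x :=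
    (pow_prime_pow_eq_self_iff p).2 (dvd_mul_right _ _)
  conv_rhs => rw [← Nat.div_add_mod i (frobPeriod p x), pow_add, pow_mul, h]

/-- Nonconjugate nonzero elements with given periods exist, unless `p = 2` and the periods coincide
and are at most `2`. -/
theorem exists_not_conj_iff {n : ℕ} (hn : 0 < n) (hK : Nat.card K = p ^ n) {k l : ℕ}
    (hk : k ∣ n) (hl : l ∣ n) :
    (∃ x y : K, x ≠ 0 ∧ y ≠ 0 ∧ frobPeriod p x = k ∧ frobPeriod p y = l ∧ ∀ i, y ≠ x ^ p ^ i) ↔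
      ¬ (p = 2 ∧ k = l ∧ k ≤ 2) := by
  have hp2 := (Fact.out : p.Prime).two_le
  have hk0 := Nat.pos_of_dvd_of_pos hk hn
  constructor
  · rintro ⟨x, y, hx, hy, rfl, hyl, hxy⟩ ⟨rfl, rfl, hle⟩
    have hxk : x ^ 2 ^ frobPeriod 2 x = x := (pow_prime_pow_eq_self_iff 2).2 dvd_rfl
    have hyk : y ^ 2 ^ frobPeriod 2 x = y := (pow_prime_pow_eq_self_iff 2).2 hyl.dvd
    have h0 := hxy 0
    have h1 := hxy 1
    have hx1 := (pow_prime_pow_eq_self_iff 2 (x := x) (j := 1))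
    have hy1 := (pow_prime_pow_eq_self_iff 2 (x := y) (j := 1))
    rw [hyl] at hy1
    have : frobPeriod 2 x = 1 ∨ frobPeriod 2 x = 2 := by omega
    rcases this with h | h
    · rw [h] at hxk hyk
      simp only [pow_one, pow_zero] at hxk hyk h0
      have e1 : x = 1 := mul_left_cancel₀ hx (by linear_combination hxk)
      have e2 : y = 1 := mul_left_cancel₀ hy (by linear_combination hyk)
      exact h0 (e2.trans e1.symm)
    · rw [h] at hxk hyk hx1 hy1
      norm_num at hxk hyk hx1 hy1 h0 h1
      have e1 : x ≠ 1 := by rintro rfl; simp at hx1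
      have e2 : y ≠ 1 := by rintro rfl; simp at hy1
      -- Period `2` in characteristic `2` means a primitive cube root of unity, and `x`, `x ^ 2` are
      -- the only two.
      have f1 : x ^ 2 + x + 1 = 0 :=
        mul_left_cancel₀ (mul_ne_zero hx (sub_ne_zero.2 e1)) (by linear_combination hxk)
      have f2 : y ^ 2 + y + 1 = 0 :=
        mul_left_cancel₀ (mul_ne_zero hy (sub_ne_zero.2 e2)) (by linear_combination hyk)
      have : (y - x) * (y - x ^ 2) = 0 := by
        linear_combination f2 + (x - 1 - y) * f1
      rcases mul_eq_zero.1 this with h | h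
      · exact h0 (sub_eq_zero.1 h)
      · exact h1 (sub_eq_zero.1 h)
  · intro h
    by_cases hkl : k = l
    · subst hkl
      have h' : ¬ (p = 2 ∧ k ≤ 2) := fun h' => h ⟨h'.1, rfl, h'.2⟩
      by_cases hk1 : k = 1
      · subst hk1
        have hp : p ≠ 2 := fun hp => h' ⟨hp, by norm_num⟩
        have hodd : Odd p := (Fact.out : p.Prime).odd_of_ne_two hp
        have hne : (-1 : K) ≠ 1 := Ring.neg_one_ne_one_of_char_ne_two (by
          rwa [ringChar.eq K p])
        refine ⟨1, -1, one_ne_zero, by simp, ?_, ?_, fun i => by simpa using hne⟩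
        · exact Nat.dvd_one.1 ((pow_prime_pow_eq_self_iff p).1 (by simp))
        · exact Nat.dvd_one.1 ((pow_prime_pow_eq_self_iff p).1 (by simp [hodd.neg_one_pow]))
      -- The witnesses are `u` and `u⁻¹` with `u` of order `p ^ k - 1`. Conjugacy would force `p ^ k
      -- - 1 ∣ p ^ i + 1` for some `i < k`, too large a divisor unless `p = 2` and `k ≤ 2`.
      · obtain ⟨u, hu⟩ := exists_orderOf_eq p hn hK hk
        refine ⟨u, (u⁻¹ : Kˣ), u.ne_zero, Units.ne_zero _, frobPeriod_eq_of_orderOf p hk0 hu,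
          frobPeriod_eq_of_orderOf p hk0 (by rw [orderOf_inv, hu]), fun i hi => ?_⟩
        have hi' : u⁻¹ = u ^ p ^ (i % k) := by
          have := eq_pow_mod_frobPeriod p (u : K) i
          rw [frobPeriod_eq_of_orderOf p hk0 hu] at this
          rw [← this] at hi
          exact Units.ext (by rw [hi, Units.val_pow_eq_pow_val])
        have h1 : p ^ k - 1 ∣ p ^ (i % k) + 1 := by
          rw [← hu, orderOf_dvd_iff_pow_eq_one, pow_succ, ← hi', inv_mul_cancel]
        have h2 := Nat.le_of_dvd (by omega) h1
        have h3 : p ^ (i % k) ≤ p ^ (k - 1) :=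
          Nat.pow_le_pow_right (by omega) (by have := Nat.mod_lt i hk0; omega)
        have h4 : p ^ k = p ^ (k - 1) * p := by rw [← pow_succ]; congr 1; omega
        have h5 : p ≤ p ^ (k - 1) := Nat.le_self_pow (by omega) p
        by_cases hp : p = 2
        · have h6 : p ^ 2 ≤ p ^ (k - 1) := Nat.pow_le_pow_right (by omega) (by omega)
          subst hp
          omega
        · have h6 : p ^ (k - 1) * 3 ≤ p ^ (k - 1) * p := Nat.mul_le_mul_left _ (by omega)
          omega
    · obtain ⟨x, hx, rfl⟩ := exists_frobPeriod_eq p hn hK hk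
      obtain ⟨y, hy, rfl⟩ := exists_frobPeriod_eq p hn hK hl
      refine ⟨x, y, hx, hy, rfl, rfl, fun i hi => hkl ?_⟩
      rw [hi, frobPeriod_pow_prime_pow]

end Conjugates

/-! ### Counting classes in a field -/

section FieldClasses

variable (p : ℕ) [Fact p.Prime] {K : Type*} [Field K] [Finite K] [CharP K p]

/-- One class for each subfield, and the extra one for the zero ring. -/
theorem ncard_range_closure_field {n : ℕ} (hn : 0 < n) (hK : Nat.card K = p ^ n) :
    (Set.range fun x : K => (NonUnitalSubring.closure {x} : Set K)).ncard
      = n.divisors.card + 1 := by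
  have h := image_closure_eq_image_frobFixed p hn hK fun _ => True
  have h' : (Set.range fun x : K => (NonUnitalSubring.closure {x} : Set K))
      = insert {0} (frobFixed p K '' n.divisors) := by
    have hs : {k | k ∈ n.divisors ∧ True} = (n.divisors : Set ℕ) := by ext; simp
    rw [← hs, ← h]
    ext B
    constructor
    · rintro ⟨x, rfl⟩
      rcases eq_or_ne x 0 with rfl | hx
      · exact Or.inl (NonUnitalSubring.coe_closure_singleton_zero K)
      · exact Or.inr ⟨x, ⟨hx, trivial⟩, rfl⟩
    · rintro (rfl | ⟨x, -, rfl⟩)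
      · exact ⟨0, NonUnitalSubring.coe_closure_singleton_zero K⟩
      · exact ⟨x, rfl⟩
  rw [h', Set.ncard_insert_of_notMem, (frobFixed_injOn p hn hK).ncard_image,
    Set.ncard_coe_finset]
  rintro ⟨k, -, hk⟩
  have : (1 : K) ∈ ({0} : Set K) := hk ▸ one_mem_frobFixed p k
  exact one_ne_zero this

/-- The condition excludes the subfield with `p ^ n` elements, which will be the scalars; what
remains are the divisors of `2 * n` that do not divide `n`. -/
theorem ncard_image_closure_field {n : ℕ} (hn : 0 < n) (hK : Nat.card K = p ^ (2 * n)) :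
    ((fun x : K => (NonUnitalSubring.closure {x} : Set K)) '' {x | x ^ p ^ n ≠ x}).ncard
      = (2 * n).divisors.card - n.divisors.card := by
  have hn2 : 0 < 2 * n := by omega
  have hs : {x : K | x ^ p ^ n ≠ x} = {x | x ≠ 0 ∧ ¬ frobPeriod p x ∣ n} := by
    ext x
    simp only [Set.mem_ofPred_eq, ne_eq, pow_prime_pow_eq_self_iff]
    refine ⟨fun h => ⟨?_, h⟩, fun h => h.2⟩
    rintro rfl
    exact h ((pow_prime_pow_eq_self_iff p).1
      (zero_pow (pow_ne_zero _ (Fact.out : p.Prime).ne_zero)))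
  have hd : {k | k ∈ (2 * n).divisors ∧ ¬ k ∣ n}
      = (((2 * n).divisors \ n.divisors : Finset ℕ) : Set ℕ) := by
    ext k
    simp [hn.ne']
  rw [hs, image_closure_eq_image_frobFixed p hn2 hK fun k => ¬ k ∣ n, hd,
    Set.InjOn.ncard_image ((frobFixed_injOn p hn2 hK).mono (by simp)),
    Set.ncard_coe_finset, Finset.card_sdiff_of_subset
      (Nat.divisors_subset_of_dvd hn2.ne' (dvd_mul_left _ _))]

end FieldClasses

/-! ### Counting classes in `K × K` -/

section SplitClasses

variable (p : ℕ) [Fact p.Prime] {K : Type*} [Field K] [Finite K] [CharP K p]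

theorem coe_closure_prod_zero_left (y : K) :
    (NonUnitalSubring.closure {((0 : K), y)} : Set (K × K))
      = {0} ×ˢ (NonUnitalSubring.closure {y} : Set K) := by
  have := NonUnitalSubring.coe_closure_singleton_map
    ((0 : K →ₙ+* K).prod (NonUnitalRingHom.id K)) y
  refine this.trans ?_
  ext ⟨a, b⟩
  simp [Prod.ext_iff, eq_comm, and_comm]

theorem coe_closure_prod_zero_right (x : K) :
    (NonUnitalSubring.closure {(x, (0 : K))} : Set (K × K))
      = (NonUnitalSubring.closure {x} : Set K) ×ˢ {0} := by
  have := NonUnitalSubring.coe_closure_singleton_map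
    ((NonUnitalRingHom.id K).prod (0 : K →ₙ+* K)) x
  refine this.trans ?_
  ext ⟨a, b⟩
  simp [Prod.ext_iff, eq_comm]

/-- The map `t ↦ (t, t ^ p ^ i)` is a ring homomorphism, so it carries generated subrings to
generated subrings. -/
theorem coe_closure_prod_conj (x : K) (i : ℕ) :
    (NonUnitalSubring.closure {(x, x ^ p ^ i)} : Set (K × K))
      = (fun t => (t, t ^ p ^ i)) '' (NonUnitalSubring.closure {x} : Set K) :=
  NonUnitalSubring.coe_closure_singleton_map
    ((NonUnitalRingHom.id K).prod (iterateFrobenius K p i : K →ₙ+* K)) x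

open Polynomial in
-- The factor `s` kills the constant term, and coefficients in `ZMod p` lift to integers.
theorem aeval_mul_mem_closure_singleton {S : Type*} [CommRing S] [Algebra (ZMod p) S]
    (s : S) (f : (ZMod p)[X]) : aeval s f * s ∈ NonUnitalSubring.closure {s} := by
  have hs : s ∈ NonUnitalSubring.closure {s} := NonUnitalSubring.mem_closure_of_mem rfl
  induction f using Polynomial.induction_on' with
  | add f g hf hg => rw [map_add, add_mul]; exact NonUnitalSubring.add_mem _ hf hg
  | monomial m a =>
    obtain ⟨z, rfl⟩ := ZMod.intCast_surjective a
    have := NonUnitalSubring.pow_mem_of_pos _ hs (Nat.succ_pos m)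
    rw [aeval_monomial, map_intCast, mul_assoc, ← pow_succ, ← zsmul_eq_mul]
    exact zsmul_mem this z

/-- The minimal polynomial of `x` vanishes at `x` but not at `y`. Evaluated at `(x, y)` it yields an
element `(0, z)` with `z ≠ 0`, then the idempotent `(0, 1)`, and this splits the subring into its
two projections. -/
theorem coe_closure_prod_of_not_conj {x y : K} (hy : y ≠ 0)
    (hxy : ∀ i, y ≠ x ^ p ^ i) :
    (NonUnitalSubring.closure {(x, y)} : Set (K × K))
      = (NonUnitalSubring.closure {x} : Set K) ×ˢ (NonUnitalSubring.closure {y} : Set K) := by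
  let _ : Algebra (ZMod p) K := ZMod.algebra K p
  have := Fintype.ofFinite K
  set B := NonUnitalSubring.closure {(x, y)} with hB
  have hs : (x, y) ∈ B := NonUnitalSubring.mem_closure_of_mem rfl
  apply Set.Subset.antisymm
  · have : B ≤ (NonUnitalSubring.closure {x}).prod (NonUnitalSubring.closure {y}) := by
      rw [hB, NonUnitalSubring.closure_le, Set.singleton_subset_iff]
      exact ⟨NonUnitalSubring.mem_closure_of_mem rfl, NonUnitalSubring.mem_closure_of_mem rfl⟩
    exact this
  · have hq : 0 < Fintype.card K - 1 := Nat.sub_pos_of_lt Fintype.one_lt_card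
    have hne : Polynomial.aeval y (minpoly (ZMod p) x) ≠ 0 := by
      intro h0
      have hint : IsIntegral (ZMod p) x := Algebra.IsIntegral.isIntegral x
      have := minpoly.eq_of_irreducible_of_monic (minpoly.irreducible hint) h0
        (minpoly.monic hint)
      obtain ⟨i, hi⟩ := (minpoly_eq_iff_exists_pow p).1 this
      exact hxy i hi
    have h1 : ((0 : K), Polynomial.aeval y (minpoly (ZMod p) x) * y) ∈ B := by
      have := aeval_mul_mem_closure_singleton p (x, y) (minpoly (ZMod p) x)
      rw [Polynomial.aeval_prod_apply] at this
      simpa using this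
    -- Raise to the power `q - 1`.
    have h2 : ((0 : K), (1 : K)) ∈ B := by
      have := NonUnitalSubring.pow_mem_of_pos _ h1 hq
      rwa [Prod.pow_mk, FiniteField.pow_card_sub_one_eq_one _ (mul_ne_zero hne hy),
        zero_pow hq.ne'] at this
    have h3 : ((0 : K), y) ∈ B := by simpa using B.mul_mem h2 hs
    have h4 : (x, (0 : K)) ∈ B := by simpa using B.sub_mem hs h3
    have h5 : NonUnitalSubring.closure {((0 : K), y)} ≤ B := by
      rwa [NonUnitalSubring.closure_le, Set.singleton_subset_iff]
    have h6 : NonUnitalSubring.closure {(x, (0 : K))} ≤ B := by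
      rwa [NonUnitalSubring.closure_le, Set.singleton_subset_iff]
    rintro ⟨a, b⟩ ⟨ha, hb⟩
    have h7 : (a, (0 : K)) ∈ B := h6 (by
      rw [← SetLike.mem_coe, coe_closure_prod_zero_right]; exact ⟨ha, rfl⟩)
    have h8 : ((0 : K), b) ∈ B := h5 (by
      rw [← SetLike.mem_coe, coe_closure_prod_zero_left]; exact ⟨rfl, hb⟩)
    simpa using B.add_mem h7 h8

/-- The pairs of divisors occurring as the periods of non-conjugate pairs. -/
def nonConjPeriods (p n : ℕ) : Finset (ℕ × ℕ) :=
  (n.divisors ×ˢ n.divisors).filter fun kl => ¬ (p = 2 ∧ kl.1 = kl.2 ∧ kl.1 ≤ 2)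

theorem card_nonConjPeriods {n : ℕ} (hn : 0 < n) :
    (nonConjPeriods p n).card + (if p = 2 then if Even n then 2 else 1 else 0)
      = n.divisors.card ^ 2 := by
  have h := Finset.card_filter_add_card_filter_not (s := n.divisors ×ˢ n.divisors)
    fun kl : ℕ × ℕ => (p = 2 ∧ kl.1 = kl.2 ∧ kl.1 ≤ 2)
  rw [Finset.card_product, ← sq, add_comm] at h
  rw [← h, nonConjPeriods, Nat.add_left_cancel_iff]
  split_ifs with hp he
  · have : (n.divisors ×ˢ n.divisors).filter (fun kl => p = 2 ∧ kl.1 = kl.2 ∧ kl.1 ≤ 2)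
        = {(1, 1), (2, 2)} := by
      ext ⟨k, l⟩
      simp only [Finset.mem_filter, Finset.mem_product, Nat.mem_divisors, Finset.mem_insert,
        Finset.mem_singleton, Prod.mk.injEq]
      constructor
      · rintro ⟨⟨hk, hl⟩, -, rfl, hle⟩
        have := Nat.pos_of_dvd_of_pos hk.1 hn
        omega
      · rintro (⟨rfl, rfl⟩ | ⟨rfl, rfl⟩)
        · simp [hp, hn.ne']
        · simp [hp, hn.ne', he.two_dvd]
    rw [this]; rfl
  · have : (n.divisors ×ˢ n.divisors).filter (fun kl => p = 2 ∧ kl.1 = kl.2 ∧ kl.1 ≤ 2)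
        = {(1, 1)} := by
      ext ⟨k, l⟩
      simp only [Finset.mem_filter, Finset.mem_product, Nat.mem_divisors,
        Finset.mem_singleton, Prod.mk.injEq]
      constructor
      · rintro ⟨⟨hk, hl⟩, -, rfl, hle⟩
        have := Nat.pos_of_dvd_of_pos hk.1 hn
        have : k ≠ 2 := by rintro rfl; exact he (even_iff_two_dvd.2 hk.1)
        omega
      · rintro ⟨rfl, rfl⟩
        simp [hp, hn.ne']
    rw [this]; rfl
  · simp [hp]

theorem ncard_image_closure_split {n : ℕ} (hn : 0 < n) (hK : Nat.card K = p ^ n) :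
    ((fun s : K × K => (NonUnitalSubring.closure {s} : Set (K × K))) ''
      {s | s.1 ≠ s.2}).ncard = CompressedCommuting.a' p n := by
  classical
  have h1m : ∀ k, (1 : K) ∈ frobFixed p K k := one_mem_frobFixed p
  have h0m : ∀ k, (0 : K) ∈ frobFixed p K k := zero_mem_frobFixed p
  have hp0 : ∀ i, p ^ i ≠ 0 := fun i => pow_ne_zero _ (Fact.out : p.Prime).ne_zero
  have hdiv : ∀ x : K, frobPeriod p x ∈ n.divisors :=
    fun x => Nat.mem_divisors.2 ⟨frobPeriod_dvd p hK x, hn.ne'⟩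
  have hinj := frobFixed_injOn p hn hK
  -- Four families: first coordinate zero, second coordinate zero, nonconjugate nonzero coordinates,
  -- conjugate nonzero coordinates. In `E₄` the exponent is reduced modulo the period and is not
  -- `0`, since the coordinates differ.
  set E₁ : Set (Set (K × K)) := (fun l => {0} ×ˢ frobFixed p K l) '' n.divisors with hE₁
  set E₂ : Set (Set (K × K)) := (fun k => frobFixed p K k ×ˢ {0}) '' n.divisors with hE₂
  set E₃ : Set (Set (K × K)) :=
    (fun kl : ℕ × ℕ => frobFixed p K kl.1 ×ˢ frobFixed p K kl.2) '' nonConjPeriods p n with hE₃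
  set E₄ : Set (Set (K × K)) :=
    (fun ki : Σ _ : ℕ, ℕ => (fun t => (t, t ^ p ^ ki.2)) '' frobFixed p K ki.1) ''
      (n.divisors.sigma fun k => Finset.Ioo 0 k) with hE₄
  have heq : (fun s : K × K => (NonUnitalSubring.closure {s} : Set (K × K))) ''
      {s | s.1 ≠ s.2} = (E₁ ∪ E₂) ∪ (E₃ ∪ E₄) := by
    ext B
    constructor
    · rintro ⟨⟨x, y⟩, hxy, rfl⟩
      have hxy : x ≠ y := hxy
      rcases eq_or_ne x 0 with rfl | hx
      · refine Or.inl (Or.inl ⟨frobPeriod p y, hdiv y, ?_⟩)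
        simp only [coe_closure_prod_zero_left, coe_closure_singleton p hxy.symm]
      rcases eq_or_ne y 0 with rfl | hy
      · refine Or.inl (Or.inr ⟨frobPeriod p x, hdiv x, ?_⟩)
        simp only [coe_closure_prod_zero_right, coe_closure_singleton p hx]
      by_cases hc : ∃ i, y = x ^ p ^ i
      · obtain ⟨i, rfl⟩ := hc
        refine Or.inr (Or.inr ⟨⟨frobPeriod p x, i % frobPeriod p x⟩, ?_, ?_⟩)
        · have hlt := Nat.mod_lt i (frobPeriod_pos p x)
          have hne : i % frobPeriod p x ≠ 0 := by
            intro h0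
            have := eq_pow_mod_frobPeriod p x i
            rw [h0, pow_zero, pow_one] at this
            exact hxy this
          simp only [Finset.coe_sigma, Set.mem_sigma_iff, Finset.mem_coe, Finset.mem_Ioo]
          exact ⟨hdiv x, Nat.pos_of_ne_zero hne, hlt⟩
        · simp only [← eq_pow_mod_frobPeriod p x i, coe_closure_prod_conj,
            coe_closure_singleton p hx]
      · push Not at hc
        refine Or.inr (Or.inl ⟨(frobPeriod p x, frobPeriod p y), ?_, ?_⟩)
        · refine Finset.mem_coe.2 (Finset.mem_filter.2
            ⟨Finset.mem_product.2 ⟨hdiv x, hdiv y⟩, ?_⟩)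
          exact (exists_not_conj_iff p hn hK (frobPeriod_dvd p hK x) (frobPeriod_dvd p hK y)).1
            ⟨x, y, hx, hy, rfl, rfl, hc⟩
        · simp only [coe_closure_prod_of_not_conj p hy hc, coe_closure_singleton p hx,
            coe_closure_singleton p hy]
    · rintro ((⟨l, hl, rfl⟩ | ⟨k, hk, rfl⟩) | (⟨⟨k, l⟩, hkl, rfl⟩ | ⟨⟨k, i⟩, hki, rfl⟩))
      · obtain ⟨y, hy, rfl⟩ := exists_frobPeriod_eq p hn hK (Nat.dvd_of_mem_divisors hl)
        refine ⟨(0, y), hy.symm, ?_⟩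
        simp only [coe_closure_prod_zero_left, coe_closure_singleton p hy]
      · obtain ⟨x, hx, rfl⟩ := exists_frobPeriod_eq p hn hK (Nat.dvd_of_mem_divisors hk)
        refine ⟨(x, 0), hx, ?_⟩
        simp only [coe_closure_prod_zero_right, coe_closure_singleton p hx]
      · have h := Finset.mem_filter.1 (Finset.mem_coe.1 hkl)
        have h' := Finset.mem_product.1 h.1
        obtain ⟨x, y, hx, hy, rfl, rfl, hc⟩ := (exists_not_conj_iff p hn hK
          (Nat.dvd_of_mem_divisors h'.1) (Nat.dvd_of_mem_divisors h'.2)).2 h.2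
        refine ⟨(x, y), fun h => hc 0 (by simpa using h.symm), ?_⟩
        simp only [coe_closure_prod_of_not_conj p hy hc, coe_closure_singleton p hx,
            coe_closure_singleton p hy]
      · simp only [Finset.coe_sigma, Set.mem_sigma_iff, Finset.mem_coe, Finset.mem_Ioo] at hki
        obtain ⟨x, hx, rfl⟩ := exists_frobPeriod_eq p hn hK (Nat.dvd_of_mem_divisors hki.1)
        refine ⟨(x, x ^ p ^ i), fun h => ?_, ?_⟩
        · have h1 := (pow_prime_pow_eq_self_iff p).1 (Eq.symm h)
          have h2 := Nat.le_of_dvd hki.2.1 h1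
          simp only at h2
          omega
        · simp only [coe_closure_prod_conj, coe_closure_singleton p hx]
  -- Which of `(1, 0)` and `(0, 1)` belong to a subring tells the four families apart.
  have m1 : ∀ B ∈ E₁, ((1 : K), (0 : K)) ∉ B ∧ ((0 : K), (1 : K)) ∈ B := by
    rintro _ ⟨l, -, rfl⟩
    simp [h1m]
  have m2 : ∀ B ∈ E₂, ((1 : K), (0 : K)) ∈ B ∧ ((0 : K), (1 : K)) ∉ B := by
    rintro _ ⟨l, -, rfl⟩
    simp [h1m]
  have m3 : ∀ B ∈ E₃, ((1 : K), (0 : K)) ∈ B ∧ ((0 : K), (1 : K)) ∈ B := by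
    rintro _ ⟨l, -, rfl⟩
    simp [h1m, h0m]
  have m4 : ∀ B ∈ E₄, ((1 : K), (0 : K)) ∉ B ∧ ((0 : K), (1 : K)) ∉ B := by
    rintro _ ⟨l, -, rfl⟩
    simp [zero_pow (hp0 _)]
  have c1 : E₁.ncard = n.divisors.card := by
    rw [hE₁, Set.InjOn.ncard_image, Set.ncard_coe_finset]
    intro k hk l hl h
    refine hinj hk hl ?_
    ext t
    have := Set.ext_iff.1 h (0, t)
    simpa using this
  have c2 : E₂.ncard = n.divisors.card := by
    rw [hE₂, Set.InjOn.ncard_image, Set.ncard_coe_finset]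
    intro k hk l hl h
    refine hinj hk hl ?_
    ext t
    have := Set.ext_iff.1 h (t, 0)
    simpa using this
  have c3 : E₃.ncard = (nonConjPeriods p n).card := by
    rw [hE₃, Set.InjOn.ncard_image, Set.ncard_coe_finset]
    rintro ⟨k, l⟩ hk ⟨k', l'⟩ hl h
    have hk := Finset.mem_product.1 (Finset.mem_filter.1 (Finset.mem_coe.1 hk)).1
    have hl := Finset.mem_product.1 (Finset.mem_filter.1 (Finset.mem_coe.1 hl)).1
    refine Prod.ext (hinj hk.1 hl.1 ?_) (hinj hk.2 hl.2 ?_)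
    · ext t
      have := Set.ext_iff.1 h (t, 0)
      simpa [h0m] using this
    · ext t
      have := Set.ext_iff.1 h (0, t)
      simpa [h0m] using this
  have c4 : E₄.ncard = ∑ k ∈ n.divisors, (k - 1) := by
    rw [hE₄, Set.InjOn.ncard_image, Set.ncard_coe_finset, Finset.card_sigma]
    · simp
    rintro ⟨k, i⟩ hk ⟨l, j⟩ hl h
    simp only [Finset.coe_sigma, Set.mem_sigma_iff, Finset.mem_coe, Finset.mem_Ioo] at hk hl
    have hkl : k = l := by
      refine hinj hk.1 hl.1 ?_
      have := congrArg (fun s => Prod.fst '' s) h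
      simpa [Set.image_image] using this
    subst hkl
    obtain ⟨x, hx, rfl⟩ := exists_frobPeriod_eq p hn hK (Nat.dvd_of_mem_divisors hk.1)
    have h2 : (x, x ^ p ^ i) ∈ (fun t => (t, t ^ p ^ j)) '' frobFixed p K (frobPeriod p x) := by
      have h := Set.ext_iff.1 h (x, x ^ p ^ i)
      exact h.1 ⟨x, mem_frobFixed_frobPeriod p x, rfl⟩
    obtain ⟨t, -, ht⟩ := h2
    simp only [Prod.mk.injEq] at ht
    obtain ⟨rfl, ht⟩ := ht
    -- Iterates of Frobenius at a point are distinct below its period.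
    have hij : i = j := by
      have e : (frobenius K p)^[i] t = (frobenius K p)^[j] t := by
        rw [iterate_frobenius, iterate_frobenius, ht]
      exact Function.iterate_injOn_Iio_minimalPeriod hk.2.2 hl.2.2 e
    rw [hij]
  have hsum : ∑ k ∈ n.divisors, (k - 1) + n.divisors.card = ∑ k ∈ n.divisors, k := by
    rw [Finset.card_eq_sum_ones, ← Finset.sum_add_distrib]
    refine Finset.sum_congr rfl fun k hk => ?_
    have := Nat.pos_of_mem_divisors hk
    omega
  rw [heq, Set.ncard_union_eq, Set.ncard_union_eq, Set.ncard_union_eq, c1, c2, c3, c4]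
  -- With `e` the correction for `p = 2`, the total is `2 d + (d ^ 2 - e) + (σ - d) = d ^ 2 + d + σ
  -- - e`.
  · have hc := card_nonConjPeriods p hn
    rw [CompressedCommuting.a', CompressedCommuting.d, CompressedCommuting.sigma, ← hc, ← hsum]
    split_ifs <;> omega
  · exact Set.disjoint_left.2 fun B h h' => (m4 B h').1 (m3 B h).1
  · exact Set.disjoint_left.2 fun B h h' => (m1 B h).1 (m2 B h').1
  · refine Set.disjoint_left.2 fun B h h' => ?_
    rcases h with h | h <;> rcases h' with h' | h'
    · exact (m1 B h).1 (m3 B h').1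
    · exact (m4 B h').2 (m1 B h).2
    · exact (m2 B h).2 (m3 B h').2
    · exact (m4 B h').1 (m2 B h).1

end SplitClasses

/-- Double counting over fibres of constant size `m`; every orbit and centralizer count below rests
on it. -/
theorem Set.ncard_eq_ncard_image_mul {α β : Type*} [Finite α] (f : α → β) (P : Set α) (m : ℕ)
    (h : ∀ a ∈ P, {b | b ∈ P ∧ f b = f a}.ncard = m) : P.ncard = (f '' P).ncard * m := by
  classical
  have := Fintype.ofFinite α
  have hP : P.ncard = P.toFinset.card := Set.ncard_eq_toFinset_card' P
  have hf : (f '' P).ncard = (P.toFinset.image f).card := by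
    rw [← Set.toFinset_image, ← Set.ncard_eq_toFinset_card']
  rw [hP, hf, Finset.card_eq_sum_card_image f, Finset.sum_const_nat]
  intro b hb
  obtain ⟨a, ha, rfl⟩ := Finset.mem_image.1 hb
  rw [← h a (Set.mem_toFinset.1 ha), ← Set.ncard_coe_finset]
  congr 1
  ext c
  simp

/-! ### Counting classes in the dual numbers -/

section DualClasses

variable (p : ℕ) [Fact p.Prime] {K : Type*} [Field K] [Finite K] [CharP K p]

/-- The lines of `K` over the fixed field of the `k`-th power of the Frobenius. -/
def frobLines (K : Type*) [Field K] (k : ℕ) : Set (Set K) :=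
  (fun y => (fun t => t * y) '' frobFixed p K k) '' {y | y ≠ 0}

theorem frobLine_eq_iff {k : ℕ} {a b : K} (hb : b ≠ 0) :
    (fun t => t * b) '' frobFixed p K k = (fun t => t * a) '' frobFixed p K k ↔
      b ∈ (fun t => t * a) '' (frobFixed p K k \ {0}) := by
  constructor
  · intro h
    have : b ∈ (fun t => t * a) '' frobFixed p K k := h ▸ ⟨1, one_mem_frobFixed p k, one_mul b⟩
    obtain ⟨t, ht, rfl⟩ := this
    exact ⟨t, ⟨ht, fun h0 => hb (by simp [Set.mem_singleton_iff.1 h0])⟩, rfl⟩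
  · rintro ⟨t, ⟨ht, ht0⟩, rfl⟩
    have ht : t ^ p ^ k = t := ht
    ext z
    constructor
    · rintro ⟨s, hs, rfl⟩
      have hs : s ^ p ^ k = s := hs
      exact ⟨s * t, by rw [frobFixed, Set.mem_ofPred_eq, mul_pow, hs, ht], mul_assoc _ _ _⟩
    · rintro ⟨s, hs, rfl⟩
      have hs : s ^ p ^ k = s := hs
      refine ⟨s * t⁻¹, by rw [frobFixed, Set.mem_ofPred_eq, mul_pow, inv_pow, hs, ht], ?_⟩
      simp only
      rw [mul_assoc, inv_mul_cancel_left₀ ht0]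

/-- Two nonzero vectors span the same line when they differ by one of the `p ^ k - 1` nonzero
scalars of the fixed field. -/
theorem ncard_frobLines {n k : ℕ} (hn : 0 < n) (hK : Nat.card K = p ^ n) (hk : k ∣ n) :
    (frobLines p K k).ncard = (p ^ n - 1) / (p ^ k - 1) := by
  have hp := (Fact.out : p.Prime).one_lt
  have h := Set.ncard_eq_ncard_image_mul (fun y => (fun t => t * y) '' frobFixed p K k)
    {y : K | y ≠ 0} (p ^ k - 1) (fun a ha => by
      have : {b : K | b ∈ {y : K | y ≠ 0} ∧ (fun t => t * b) '' frobFixed p K k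
          = (fun t => t * a) '' frobFixed p K k} = (fun t => t * a) '' (frobFixed p K k \ {0}) := by
        ext b
        constructor
        · rintro ⟨hb, h⟩
          exact (frobLine_eq_iff p hb).1 h
        · intro hb
          have hb0 : b ≠ 0 := by
            obtain ⟨t, ht, rfl⟩ := hb
            exact mul_ne_zero ht.2 ha
          exact ⟨hb0, (frobLine_eq_iff p hb0).2 hb⟩
      rw [this, Set.ncard_image_of_injective _ (mul_left_injective₀ ha),
        Set.ncard_sdiff_singleton_of_mem (zero_mem_frobFixed p k), ncard_frobFixed p hn hK hk])
  have hc : {y : K | y ≠ 0}.ncard = p ^ n - 1 := by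
    have : {y : K | y ≠ 0} = Set.univ \ {0} := by ext; simp
    rw [this, Set.ncard_sdiff_singleton_of_mem (Set.mem_univ _), Set.ncard_univ, hK]
  rw [hc] at h
  rw [h]
  refine (Nat.mul_div_cancel _ ?_).symm
  have := Nat.one_lt_pow (Nat.pos_of_dvd_of_pos hk hn).ne' hp
  omega

open DualNumber TrivSqZeroExt

/-- Raising to the power `p ^ n` is additive, fixes the field and kills `ε`, so it extracts the
field part of `s` inside the subring it generates. -/
theorem dualNumber_pow_card {n : ℕ} (hn : 0 < n) (hK : Nat.card K = p ^ n) (s : K[ε]) :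
    s ^ p ^ n = inl s.fst := by
  have hs : s = inl s.fst + inr s.snd := (inl_fst_add_inr_snd_eq s).symm
  have : CharP K[ε] p := charP_of_injective_algebraMap (algebraMap K K[ε]).injective p
  have h2 : 2 ≤ p ^ n := (Fact.out : p.Prime).two_le.trans (Nat.le_self_pow hn.ne' p)
  conv_lhs => rw [hs]
  rw [add_pow_char_pow, show (inl s.fst : K[ε]) ^ p ^ n = inl (s.fst ^ p ^ n) from
    ((inlHom K K).map_pow s.fst (p ^ n)).symm, pow_prime_pow_eq_self p hK, ← Nat.add_sub_of_le h2, pow_add,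
    sq, inr_mul_inr, zero_mul, add_zero]

theorem frobFixed_add_mem {k : ℕ} {a b : K} (ha : a ∈ frobFixed p K k) (hb : b ∈ frobFixed p K k) :
    a + b ∈ frobFixed p K k := by
  have ha : a ^ p ^ k = a := ha
  have hb : b ^ p ^ k = b := hb
  rw [frobFixed, Set.mem_ofPred_eq, add_pow_char_pow, ha, hb]

theorem frobFixed_mul_mem {k : ℕ} {a b : K} (ha : a ∈ frobFixed p K k) (hb : b ∈ frobFixed p K k) :
    a * b ∈ frobFixed p K k := by
  have ha : a ^ p ^ k = a := ha
  have hb : b ^ p ^ k = b := hb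
  rw [frobFixed, Set.mem_ofPred_eq, mul_pow, ha, hb]

theorem frobFixed_neg_mem {k : ℕ} {a : K} (ha : a ∈ frobFixed p K k) : -a ∈ frobFixed p K k :=
  ((iterateFrobenius K p k).map_neg a).trans (congrArg Neg.neg ha)

theorem exists_intCast_of_mem_frobFixed_one {m : K} (hm : m ∈ frobFixed p K 1) :
    ∃ z : ℤ, (z : K) = m := by
  have h1 : frobPeriod p (1 : K) = 1 :=
    Nat.dvd_one.1 ((pow_prime_pow_eq_self_iff p).1 (one_pow _))
  rw [← h1, ← coe_closure_singleton p one_ne_zero] at hm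
  have : NonUnitalSubring.closure {(1 : K)} ≤ (Int.castRingHom K).range.toNonUnitalSubring := by
    rw [NonUnitalSubring.closure_le, Set.singleton_subset_iff]
    exact ⟨1, by simp⟩
  exact this hm

/-- Since `inr y` squares to zero, only its integer multiples occur, that is, its prime field line.
-/
theorem coe_closure_inr (y : K) :
    (NonUnitalSubring.closure {(inr y : K[ε])} : Set K[ε])
      = {s | s.fst = 0 ∧ s.snd ∈ (fun t => t * y) '' frobFixed p K 1} := by
  apply Set.Subset.antisymm
  · intro s hs
    induction hs using NonUnitalSubring.closure_induction with
    | mem x hx =>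
      rw [Set.mem_singleton_iff.1 hx]
      exact ⟨rfl, 1, one_mem_frobFixed p 1, one_mul y⟩
    | zero => exact ⟨rfl, 0, zero_mem_frobFixed p 1, zero_mul y⟩
    | add a b _ _ ha hb =>
      obtain ⟨ha, t, ht, hta⟩ := ha
      obtain ⟨hb, t', ht', htb⟩ := hb
      simp only at hta htb
      exact ⟨by simp [ha, hb], t + t', frobFixed_add_mem p ht ht', by simp [← hta, ← htb, add_mul]⟩
    | neg a _ ha =>
      obtain ⟨ha, t, ht, hta⟩ := ha
      simp only at hta
      exact ⟨by simp [ha], -t, frobFixed_neg_mem p ht, by simp [← hta]⟩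
    | mul a b _ _ ha hb =>
      exact ⟨by simp [ha.1], 0, zero_mem_frobFixed p 1, by simp [ha.1, hb.1]⟩
  · rintro s ⟨hs, t, ht, hts⟩
    obtain ⟨z, rfl⟩ := exists_intCast_of_mem_frobFixed_one p ht
    have : s = z • inr y := by
      ext
      · simp [hs]
      · simp [← hts, mul_comm]
    rw [this]
    exact zsmul_mem (NonUnitalSubring.mem_closure_of_mem (Set.mem_singleton _)) z

/-- A power of `s` isolates `inl s.fst`, hence also `inr s.snd`. The first generates the subfield
`k`, which then acts on the second; conversely `k + k s.snd ε` is closed under multiplication. -/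
theorem coe_closure_dualNumber {n : ℕ} (hn : 0 < n) (hK : Nat.card K = p ^ n) {s : K[ε]}
    (hs : s.fst ≠ 0) : (NonUnitalSubring.closure {s} : Set K[ε])
      = {t | t.fst ∈ frobFixed p K (frobPeriod p s.fst) ∧
          t.snd ∈ (fun t => t * s.snd) '' frobFixed p K (frobPeriod p s.fst)} := by
  set k := frobPeriod p s.fst with hk
  apply Set.Subset.antisymm
  · intro u hu
    induction hu using NonUnitalSubring.closure_induction with
    | mem x hx =>
      rw [Set.mem_singleton_iff.1 hx]
      exact ⟨mem_frobFixed_frobPeriod p _, 1, one_mem_frobFixed p k, one_mul _⟩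
    | zero => exact ⟨zero_mem_frobFixed p k, 0, zero_mem_frobFixed p k, zero_mul _⟩
    | add a b _ _ ha hb =>
      obtain ⟨ha, t, ht, hta⟩ := ha
      obtain ⟨hb, t', ht', htb⟩ := hb
      simp only at hta htb
      exact ⟨frobFixed_add_mem p ha hb, t + t', frobFixed_add_mem p ht ht',
        by simp [← hta, ← htb, add_mul]⟩
    | neg a _ ha =>
      obtain ⟨ha, t, ht, hta⟩ := ha
      simp only at hta
      exact ⟨frobFixed_neg_mem p ha, -t, frobFixed_neg_mem p ht, by simp [← hta]⟩
    | mul a b _ _ ha hb =>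
      obtain ⟨ha, t, ht, hta⟩ := ha
      obtain ⟨hb, t', ht', htb⟩ := hb
      simp only at hta htb
      refine ⟨by rw [fst_mul]; exact frobFixed_mul_mem p ha hb, a.fst * t' + t * b.fst,
        frobFixed_add_mem p (frobFixed_mul_mem p ha ht') (frobFixed_mul_mem p ht hb), ?_⟩
      simp only
      rw [DualNumber.snd_mul, ← hta, ← htb]
      ring
  · set B := NonUnitalSubring.closure {s} with hB
    have hsB : s ∈ B := NonUnitalSubring.mem_closure_of_mem (Set.mem_singleton _)
    have hx : inl s.fst ∈ B := by
      have := NonUnitalSubring.pow_mem_of_pos B hsB (Nat.pow_pos (n := n)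
        (Fact.out : p.Prime).pos)
      rwa [dualNumber_pow_card p hn hK] at this
    have hy : inr s.snd ∈ B := by
      have := B.sub_mem hsB hx
      rwa [sub_eq_of_eq_add' (inl_fst_add_inr_snd_eq s).symm] at this
    have hin : ∀ m ∈ frobFixed p K k, inl m ∈ B := by
      intro m hm
      rw [hk, ← coe_closure_singleton p hs] at hm
      have h1 := NonUnitalSubring.coe_closure_singleton_map
        (inlHom K K : K →ₙ+* K[ε]) s.fst
      have h2 : inl m ∈ (NonUnitalSubring.closure {(inlHom K K : K →ₙ+* K[ε]) s.fst}
          : Set K[ε]) := by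
        rw [h1]
        exact ⟨m, hm, rfl⟩
      have h3 : NonUnitalSubring.closure {(inlHom K K : K →ₙ+* K[ε]) s.fst} ≤ B := by
        rw [NonUnitalSubring.closure_le, Set.singleton_subset_iff]
        exact hx
      exact h3 h2
    rintro u ⟨hu, t, ht, htu⟩
    simp only at htu
    have : u = inl u.fst + inl t * inr s.snd := by
      ext
      · simp
      · simp [← htu, mul_comm]
    rw [this]
    exact B.add_mem (hin _ hu) (B.mul_mem (hin _ ht) hy)

theorem ncard_image_closure_dualNumber {n : ℕ} (hn : 0 < n) (hK : Nat.card K = p ^ n) :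
    ((fun s : K[ε] => (NonUnitalSubring.closure {s} : Set K[ε])) '' {s | s.snd ≠ 0}).ncard
      = CompressedCommuting.b' p n := by
  classical
  have hfin : ∀ k, (frobLines p K k).Finite := fun k => Set.toFinite _
  have hdiv : ∀ x : K, frobPeriod p x ∈ n.divisors :=
    fun x => Nat.mem_divisors.2 ⟨frobPeriod_dvd p hK x, hn.ne'⟩
  -- `E₁` collects the subrings generated by nilpotents and `E₂` the rest, indexed by a subfield and
  -- a line over it. Only members of `E₂` contain `1`.
  set E₁ : Set (Set K[ε]) := (fun U => {s : K[ε] | s.fst = 0 ∧ s.snd ∈ U}) '' frobLines p K 1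
    with hE₁
  set E₂ : Set (Set K[ε]) :=
    (fun kU : Σ _ : ℕ, Set K => {s : K[ε] | s.fst ∈ frobFixed p K kU.1 ∧ s.snd ∈ kU.2}) ''
      (n.divisors.sigma fun k => (hfin k).toFinset) with hE₂
  have heq : (fun s : K[ε] => (NonUnitalSubring.closure {s} : Set K[ε])) '' {s | s.snd ≠ 0}
      = E₁ ∪ E₂ := by
    ext B
    constructor
    · rintro ⟨s, hs, rfl⟩
      by_cases h0 : s.fst = 0
      · refine Or.inl ⟨_, ⟨s.snd, hs, rfl⟩, ?_⟩
        have : s = inr s.snd := by ext <;> simp [h0]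
        conv_rhs => rw [this]
        exact (coe_closure_inr p s.snd).symm
      · refine Or.inr ⟨⟨frobPeriod p s.fst, _⟩, ?_, (coe_closure_dualNumber p hn hK h0).symm⟩
        rw [Finset.coe_sigma, Set.mem_sigma_iff]
        exact ⟨hdiv _, Finset.mem_coe.2 ((hfin _).mem_toFinset.2 ⟨s.snd, hs, rfl⟩)⟩
    · rintro (⟨_, ⟨y, hy, rfl⟩, rfl⟩ | ⟨⟨k, U⟩, hkU, rfl⟩)
      · exact ⟨inr y, hy, coe_closure_inr p y⟩
      · simp only [Finset.coe_sigma, Set.mem_sigma_iff, Finset.mem_coe,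
          Set.Finite.mem_toFinset] at hkU
        obtain ⟨hk, y, hy, rfl⟩ := hkU
        obtain ⟨x, hx, rfl⟩ := exists_frobPeriod_eq p hn hK (Nat.dvd_of_mem_divisors hk)
        have hxy : (inl x + inr y : K[ε]).fst = x := by simp
        have hxy' : (inl x + inr y : K[ε]).snd = y := by simp
        refine ⟨inl x + inr y, by rw [Set.mem_ofPred_eq, hxy']; exact hy, ?_⟩
        have := coe_closure_dualNumber p hn hK (s := inl x + inr y) (by rwa [hxy])
        rw [hxy, hxy'] at this
        exact this
  have hzero : ∀ k, ∀ U ∈ frobLines p K k, (0 : K) ∈ U := by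
    rintro k _ ⟨y, -, rfl⟩
    exact ⟨0, zero_mem_frobFixed p k, zero_mul y⟩
  have c1 : E₁.ncard = (p ^ n - 1) / (p - 1) := by
    rw [hE₁, Set.InjOn.ncard_image, ncard_frobLines p hn hK (one_dvd n), pow_one]
    intro U _ V _ h
    ext t
    have := Set.ext_iff.1 h (inr t)
    simpa using this
  have c2 : E₂.ncard = ∑ k ∈ n.divisors, (p ^ n - 1) / (p ^ k - 1) := by
    rw [hE₂, Set.InjOn.ncard_image, Set.ncard_coe_finset, Finset.card_sigma]
    · refine Finset.sum_congr rfl fun k hk => ?_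
      rw [← Set.ncard_eq_toFinset_card, ncard_frobLines p hn hK (Nat.dvd_of_mem_divisors hk)]
    · rintro ⟨k, U⟩ hkU ⟨l, V⟩ hlV h
      simp only [Finset.coe_sigma, Set.mem_sigma_iff, Finset.mem_coe,
          Set.Finite.mem_toFinset] at hkU hlV h
      have hkl : k = l := by
        refine frobFixed_injOn p hn hK hkU.1 hlV.1 ?_
        ext t
        have := Set.ext_iff.1 h (inl t)
        simpa [hzero _ _ hkU.2, hzero _ _ hlV.2] using this
      subst hkl
      have hUV : U = V := by
        ext t
        have := Set.ext_iff.1 h (inr t)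
        simpa [zero_mem_frobFixed p k] using this
      rw [hUV]
  rw [heq, Set.ncard_union_eq, c1, c2, CompressedCommuting.b']
  refine Set.disjoint_left.2 ?_
  rintro _ ⟨U, hU, rfl⟩ ⟨⟨k, V⟩, hV, h⟩
  simp only [Finset.coe_sigma, Set.mem_sigma_iff, Finset.mem_coe,
    Set.Finite.mem_toFinset] at hV
  have := (Set.ext_iff.1 h (1 : K[ε])).1 ⟨one_mem_frobFixed p k, hzero _ _ hV.2⟩
  exact one_ne_zero this.1

end DualClasses

/-! ### Centralizers of `2 × 2` matrices -/

section TwoByTwo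

open Matrix

variable {F : Type*} [Field F]

/-- The nonscalar `2 × 2` matrices. -/
def nonscalar (F : Type*) [Field F] : Set (Matrix (Fin 2) (Fin 2) F) := {a | ∀ r : F, a ≠ r • 1}

/-- The idempotents other than `0` and `1`. -/
def properIdempotents (F : Type*) [Field F] : Set (Matrix (Fin 2) (Fin 2) F) :=
  {e | e * e = e ∧ e ≠ 0 ∧ e ≠ 1}

/-- The nonzero matrices of square zero. -/
def nonzeroNilpotents (F : Type*) [Field F] : Set (Matrix (Fin 2) (Fin 2) F) :=
  {N | N * N = 0 ∧ N ≠ 0}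

/-- The nonscalar matrices without eigenvalues. -/
def withoutEigenvalues (F : Type*) [Field F] : Set (Matrix (Fin 2) (Fin 2) F) :=
  {a | a ∈ nonscalar F ∧ ∀ r : F, (a - r • 1).det ≠ 0}

theorem mem_centralizer_singleton {R : Type*} [Mul R] {a b : R} :
    b ∈ Set.centralizer {a} ↔ a * b = b * a := by
  simp [Set.mem_centralizer_iff]

variable {a b : Matrix (Fin 2) (Fin 2) F}

/-- A nonscalar matrix has a nonzero off-diagonal entry or distinct diagonal entries; the ratio of
the corresponding quantities for `b` and `a` is the coefficient `y`. -/
theorem eq_smul_one_add_smul_of_commute (ha : a ∈ nonscalar F) (h : a * b = b * a) :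
    ∃ x y : F, b = x • 1 + y • a := by
  have h00 := congrFun (congrFun h 0) 0
  have h01 := congrFun (congrFun h 0) 1
  have h10 := congrFun (congrFun h 1) 0
  simp only [Matrix.mul_apply, Fin.sum_univ_two] at h00 h01 h10
  by_cases h1 : a 0 1 = 0
  · by_cases h2 : a 1 0 = 0
    · have h3 : a 0 0 - a 1 1 ≠ 0 := by
        intro h3
        refine ha (a 0 0) ?_
        ext i j
        fin_cases i <;> fin_cases j <;> simp [h1, h2, (sub_eq_zero.1 h3).symm]
      have hb01 : b 0 1 = 0 :=
        mul_left_cancel₀ h3 (by rw [h1] at h01; linear_combination h01)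
      have hb10 : b 1 0 = 0 :=
        mul_left_cancel₀ h3 (by rw [h2] at h10; linear_combination -h10)
      refine ⟨b 0 0 - (b 0 0 - b 1 1) / (a 0 0 - a 1 1) * a 0 0,
        (b 0 0 - b 1 1) / (a 0 0 - a 1 1), ?_⟩
      ext i j
      fin_cases i <;> fin_cases j <;> simp [h1, h2, hb01, hb10]
      field_simp
      ring
    · refine ⟨b 0 0 - b 1 0 / a 1 0 * a 0 0, b 1 0 / a 1 0, ?_⟩
      ext i j
      fin_cases i <;> fin_cases j <;> simp [h1, h2]
      · exact (mul_eq_zero.1 (by rw [h1] at h00; linear_combination -h00 :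
          a 1 0 * b 0 1 = 0)).resolve_left h2
      · field_simp
        linear_combination -h10
  · refine ⟨b 0 0 - b 0 1 / a 0 1 * a 0 0, b 0 1 / a 0 1, ?_⟩
    ext i j
    fin_cases i <;> fin_cases j <;> simp [h1]
    · field_simp
      linear_combination h00
    · field_simp
      linear_combination h01

theorem mem_centralizer_iff_exists (ha : a ∈ nonscalar F) :
    b ∈ Set.centralizer {a} ↔ ∃ x y : F, x • 1 + y • a = b := by
  rw [mem_centralizer_singleton]
  constructor
  · intro h
    obtain ⟨x, y, h⟩ := eq_smul_one_add_smul_of_commute ha h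
    exact ⟨x, y, h.symm⟩
  · rintro ⟨x, y, rfl⟩
    simp [mul_add, add_mul]

theorem smul_one_add_smul_inj (ha : a ∈ nonscalar F) {x y x' y' : F}
    (h : x • 1 + y • a = x' • 1 + y' • a) : x = x' ∧ y = y' := by
  have h1 : (y - y') • a = (x' - x) • (1 : Matrix (Fin 2) (Fin 2) F) := by
    rw [sub_smul, sub_smul, sub_eq_sub_iff_add_eq_add, add_comm, h, add_comm]
  have hy : y - y' = 0 := by
    by_contra hy
    refine ha ((y - y')⁻¹ * (x' - x)) ?_
    rw [mul_smul, ← h1, smul_smul, inv_mul_cancel₀ hy, one_smul]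
  rw [hy, zero_smul, eq_comm, smul_eq_zero] at h1
  exact ⟨(sub_eq_zero.1 (h1.resolve_right one_ne_zero)).symm, sub_eq_zero.1 hy⟩

theorem smul_one_add_smul_mem_nonscalar_iff (ha : a ∈ nonscalar F) {x y : F} :
    x • 1 + y • a ∈ nonscalar F ↔ y ≠ 0 := by
  constructor
  · rintro h rfl
    exact h x (by simp)
  · intro hy r h
    exact hy (smul_one_add_smul_inj ha (x' := r) (y' := 0) (by simpa using h)).2

/-- If `b` commutes with `a`, it commutes with `F + F a`, which is the whole centralizer of `a`;
then exchange the roles. This makes commuting transitive on nonscalars. -/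
theorem commute_iff_centralizer_eq (ha : a ∈ nonscalar F) (hb : b ∈ nonscalar F) :
    a * b = b * a ↔ Set.centralizer {a} = Set.centralizer {b} := by
  have key : ∀ {a b : Matrix (Fin 2) (Fin 2) F}, a ∈ nonscalar F → a * b = b * a →
      Set.centralizer {a} ⊆ Set.centralizer {b} := by
    intro a b ha h c hc
    obtain ⟨x, y, rfl⟩ := (mem_centralizer_iff_exists ha).1 hc
    rw [mem_centralizer_singleton]
    simp [mul_add, add_mul, h]
  constructor
  · exact fun h => (key ha h).antisymm (key hb h.symm)
  · intro h
    have : b ∈ Set.centralizer {a} := h ▸ mem_centralizer_singleton.2 rfl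
    exact mem_centralizer_singleton.1 this

theorem centralizer_eq_univ_iff : Set.centralizer {a} = Set.univ ↔ a ∉ nonscalar F := by
  constructor
  · intro h ha
    have h1 : ∀ b, ∃ x y : F, x • 1 + y • a = b :=
      fun b => (mem_centralizer_iff_exists ha).1 (h ▸ Set.mem_univ b)
    have h2 : ∀ b c : Matrix (Fin 2) (Fin 2) F, b * c = c * b := by
      intro b c
      obtain ⟨x, y, rfl⟩ := h1 b
      obtain ⟨z, w, rfl⟩ := h1 c
      simp [mul_add, add_mul, smul_smul, mul_comm]
      abel
    have := congrFun (congrFun (h2 !![0, 1; 0, 0] !![0, 0; 1, 0]) 0) 0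
    simp at this
  · intro ha
    simp only [nonscalar, ne_eq, Set.mem_ofPred_eq, not_forall, not_not] at ha
    obtain ⟨r, rfl⟩ := ha
    ext b
    simp [mem_centralizer_singleton]

theorem setOf_centralizer_eq (ha : a ∈ nonscalar F) :
    {b | Set.centralizer {b} = Set.centralizer {a}}
      = {b | b ∈ nonscalar F ∧ b ∈ Set.centralizer {a}} := by
  ext b
  constructor
  · intro h
    have hb : b ∈ nonscalar F := by
      by_contra hb
      exact centralizer_eq_univ_iff.1 (h.symm.trans (centralizer_eq_univ_iff.2 hb)) ha
    exact ⟨hb, mem_centralizer_singleton.2 ((commute_iff_centralizer_eq ha hb).2 (Eq.symm h))⟩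
  · rintro ⟨hb, h⟩
    exact ((commute_iff_centralizer_eq ha hb).1 (mem_centralizer_singleton.1 h)).symm

theorem properIdempotents_subset : properIdempotents F ⊆ nonscalar F := by
  rintro e ⟨h, h0, h1⟩ r rfl
  have h2 : r * r = r := by simpa using congrFun (congrFun h 0) 0
  rcases eq_or_ne r 0 with rfl | hr
  · exact h0 (zero_smul _ _)
  · exact h1 (by rw [mul_left_cancel₀ hr (h2.trans (mul_one r).symm), one_smul])

theorem nonzeroNilpotents_subset : nonzeroNilpotents F ⊆ nonscalar F := by
  rintro N ⟨h, h0⟩ r rfl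
  have h2 : r * r = 0 := by simpa using congrFun (congrFun h 0) 0
  exact h0 (by rw [mul_self_eq_zero.1 h2, zero_smul])

/-- Cayley–Hamilton for a singular matrix. -/
theorem mul_self_eq_smul_of_det_eq_zero (h : a.det = 0) : a * a = (a 0 0 + a 1 1) • a := by
  rw [Matrix.det_fin_two] at h
  ext i j
  fin_cases i <;> fin_cases j <;> simp [Matrix.mul_apply, Fin.sum_univ_two] <;>
    first | ring1 | linear_combination -h

theorem centralizer_smul_one_add_smul (ha : a ∈ nonscalar F) {x y : F} (hy : y ≠ 0) :
    Set.centralizer {x • 1 + y • a} = Set.centralizer {a} :=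
  (commute_iff_centralizer_eq ((smul_one_add_smul_mem_nonscalar_iff ha).2 hy) ha).1 (by
    simp [mul_add, add_mul])

/-- The centralizers of the nonscalar matrices come in three types. -/
theorem image_centralizer_nonscalar :
    (fun a : Matrix (Fin 2) (Fin 2) F => Set.centralizer {a}) '' nonscalar F =
      ((fun a => Set.centralizer {a}) '' properIdempotents F ∪
        (fun a => Set.centralizer {a}) '' nonzeroNilpotents F) ∪
        (fun a => Set.centralizer {a}) '' withoutEigenvalues F := by
  apply Set.Subset.antisymm
  · rintro _ ⟨a, ha, rfl⟩
    by_cases hr : ∀ r : F, (a - r • 1).det ≠ 0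
    · exact Or.inr ⟨a, ⟨ha, hr⟩, rfl⟩
    · push Not at hr
      obtain ⟨r, hr⟩ := hr
      have hm : a - r • 1 = (-r) • 1 + (1 : F) • a := by
        rw [neg_smul, one_smul]; abel
      have hC := centralizer_smul_one_add_smul ha (x := -r) (one_ne_zero (α := F))
      have hN := (smul_one_add_smul_mem_nonscalar_iff ha (x := -r)).2 (one_ne_zero (α := F))
      rw [← hm] at hC hN
      set m := a - r • 1
      -- Subtracting an eigenvalue leaves a singular `m` with the same centralizer and `m * m =
      -- tr(m) • m`: it is nilpotent if the trace vanishes, and otherwise `m / tr(m)` is idempotent.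
      have hsq := mul_self_eq_smul_of_det_eq_zero hr
      have hm0 : m ≠ 0 := fun h => hN 0 (by rw [h, zero_smul])
      left
      by_cases ht : m 0 0 + m 1 1 = 0
      · rw [ht, zero_smul] at hsq
        exact Or.inr ⟨m, ⟨hsq, hm0⟩, hC⟩
      · set t := m 0 0 + m 1 1
        have hti := inv_ne_zero ht
        have hC' := centralizer_smul_one_add_smul hN (x := 0) hti
        have hN' := (smul_one_add_smul_mem_nonscalar_iff hN (x := 0)).2 hti
        rw [zero_smul, zero_add] at hC' hN'
        refine Or.inl ⟨t⁻¹ • m, ⟨?_, ?_, ?_⟩, hC'.trans hC⟩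
        · rw [smul_mul_smul_comm, hsq, smul_smul, mul_assoc, inv_mul_cancel₀ ht, mul_one]
        · exact smul_ne_zero hti hm0
        · exact fun h => hN' 1 (by rw [h, one_smul])
  · rintro A ((⟨a, ha, rfl⟩ | ⟨a, ha, rfl⟩) | ⟨a, ha, rfl⟩)
    · exact ⟨a, properIdempotents_subset ha, rfl⟩
    · exact ⟨a, nonzeroNilpotents_subset ha, rfl⟩
    · exact ⟨a, ha.1, rfl⟩

theorem disjoint_centralizer_idempotent_nilpotent :
    Disjoint ((fun a => Set.centralizer {a}) '' properIdempotents F)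
      ((fun a => Set.centralizer {a}) '' nonzeroNilpotents F) := by
  refine Set.disjoint_left.2 ?_
  rintro _ ⟨e, he, rfl⟩ ⟨N, hN, h⟩
  have hNe : N ∈ Set.centralizer {e} := by
    simp only at h
    rw [← h]; exact mem_centralizer_singleton.2 rfl
  obtain ⟨x, y, rfl⟩ := (mem_centralizer_iff_exists (properIdempotents_subset he)).1 hNe
  have h1 : (x * x) • (1 : Matrix (Fin 2) (Fin 2) F) + (2 * x * y + y * y) • e
      = (0 : F) • 1 + (0 : F) • e := by
    rw [zero_smul, zero_smul, add_zero, ← hN.1]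
    simp only [mul_add, add_mul, smul_mul_smul_comm, one_mul, mul_one, he.1]
    module
  obtain ⟨h2, h3⟩ := smul_one_add_smul_inj (properIdempotents_subset he) h1
  have hx := mul_self_eq_zero.1 h2
  rw [hx, mul_zero, zero_mul, zero_add] at h3
  exact hN.2 (by rw [hx, mul_self_eq_zero.1 h3]; simp)

/-- If `a = x + y b` with `b` singular, then `a - x` is singular and `x` is an eigenvalue of `a`. -/
theorem centralizer_ne_of_det_eq_zero (hb : b ∈ nonscalar F) (hdet : b.det = 0)
    (ha : a ∈ withoutEigenvalues F) : Set.centralizer {a} ≠ Set.centralizer {b} := by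
  intro h
  have hab : a ∈ Set.centralizer {b} := h ▸ mem_centralizer_singleton.2 rfl
  obtain ⟨x, y, rfl⟩ := (mem_centralizer_iff_exists hb).1 hab
  refine ha.2 x ?_
  rw [add_sub_cancel_left, Matrix.det_smul, hdet, mul_zero]

theorem det_eq_zero_of_mem_properIdempotents {e : Matrix (Fin 2) (Fin 2) F}
    (he : e ∈ properIdempotents F) : e.det = 0 := by
  by_contra h
  have hu : IsUnit e := (Matrix.isUnit_iff_isUnit_det e).2 (isUnit_iff_ne_zero.2 h)
  exact he.2.2 (hu.mul_left_cancel (he.1.trans (mul_one e).symm))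

theorem det_eq_zero_of_mem_nonzeroNilpotents {N : Matrix (Fin 2) (Fin 2) F}
    (hN : N ∈ nonzeroNilpotents F) : N.det = 0 := by
  have := congrArg Matrix.det hN.1
  rw [Matrix.det_mul] at this
  simpa using this

theorem disjoint_centralizer_withoutEigenvalues :
    Disjoint ((fun a => Set.centralizer {a}) '' properIdempotents F ∪
        (fun a => Set.centralizer {a}) '' nonzeroNilpotents F)
      ((fun a => Set.centralizer {a}) '' withoutEigenvalues F) := by
  refine Set.disjoint_left.2 ?_
  rintro _ (⟨e, he, rfl⟩ | ⟨e, he, rfl⟩) ⟨a, ha, h⟩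
  · exact centralizer_ne_of_det_eq_zero (properIdempotents_subset he)
      (det_eq_zero_of_mem_properIdempotents he) ha h
  · exact centralizer_ne_of_det_eq_zero (nonzeroNilpotents_subset he)
      (det_eq_zero_of_mem_nonzeroNilpotents he) ha h

end TwoByTwo

/-! ### Counting the centralizers of each type -/

section CountingCentralizers

open Matrix

variable {F : Type*} [Field F] [Finite F] {a : Matrix (Fin 2) (Fin 2) F}

theorem ncard_setOf_ne_zero (F : Type*) [Field F] [Finite F] :
    {y : F | y ≠ 0}.ncard = Nat.card F - 1 := by
  have : {y : F | y ≠ 0} = Set.univ \ {0} := by ext; simp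
  rw [this, Set.ncard_sdiff_singleton_of_mem (Set.mem_univ _), Set.ncard_univ]

theorem setOf_nonscalar_centralizer_eq (ha : a ∈ nonscalar F) :
    {b | b ∈ nonscalar F ∧ b ∈ Set.centralizer {a}}
      = (fun xy : F × F => xy.1 • 1 + xy.2 • a) '' (Set.univ ×ˢ {y | y ≠ 0}) := by
  ext b
  constructor
  · rintro ⟨hb, h⟩
    obtain ⟨x, y, rfl⟩ := (mem_centralizer_iff_exists ha).1 h
    exact ⟨(x, y), ⟨trivial, (smul_one_add_smul_mem_nonscalar_iff ha).1 hb⟩, rfl⟩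
  · rintro ⟨⟨x, y⟩, ⟨-, hy⟩, rfl⟩
    exact ⟨(smul_one_add_smul_mem_nonscalar_iff ha).2 hy,
      (mem_centralizer_iff_exists ha).2 ⟨x, y, rfl⟩⟩

theorem ncard_nonscalar (F : Type*) [Field F] [Finite F] :
    (nonscalar F).ncard = Nat.card F ^ 4 - Nat.card F := by
  have h : nonscalar F
      = (Set.range fun r : F => (r • 1 : Matrix (Fin 2) (Fin 2) F))ᶜ := by
    ext a
    simp [nonscalar, eq_comm]
  have hinj : Function.Injective fun r : F => (r • 1 : Matrix (Fin 2) (Fin 2) F) :=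
    smul_left_injective F one_ne_zero
  have hc : Nat.card (Matrix (Fin 2) (Fin 2) F) = Nat.card F ^ 4 := by
    rw [Matrix, Nat.card_fun, Nat.card_fun, Nat.card_fin, ← pow_mul]
  rw [h, Set.ncard_compl, hc, ← Set.image_univ, Set.ncard_image_of_injective _ hinj,
    Set.ncard_univ]

/-- Each centralizer contains `q (q - 1)` nonscalars, namely `x + y a` with `y ≠ 0`, and `q ^ 4 - q
= (q ^ 2 + q + 1) q (q - 1)`. -/
theorem ncard_centralizers_nonscalar (F : Type*) [Field F] [Finite F] :
    ((fun a : Matrix (Fin 2) (Fin 2) F => Set.centralizer {a}) '' nonscalar F).ncard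
      = Nat.card F ^ 2 + Nat.card F + 1 := by
  have h := Set.ncard_eq_ncard_image_mul
    (fun a : Matrix (Fin 2) (Fin 2) F => Set.centralizer {a}) (nonscalar F)
    (Nat.card F * (Nat.card F - 1)) (fun a ha => by
      have : {b | b ∈ nonscalar F ∧ Set.centralizer {b} = Set.centralizer {a}}
          = {b | b ∈ nonscalar F ∧ b ∈ Set.centralizer {a}} := by
        rw [← setOf_centralizer_eq ha]
        ext b
        refine ⟨fun h => h.2, fun h => ⟨?_, h⟩⟩
        have h' := (setOf_centralizer_eq ha).subset h
        exact h'.1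
      rw [this, setOf_nonscalar_centralizer_eq ha, Set.ncard_image_of_injective,
        Set.ncard_prod, Set.ncard_univ, ncard_setOf_ne_zero]
      rintro ⟨x, y⟩ ⟨z, w⟩ hxy
      exact Prod.ext_iff.2 (smul_one_add_smul_inj ha hxy))
  have hq : 1 < Nat.card F := Finite.one_lt_card
  rw [ncard_nonscalar] at h
  obtain ⟨m, hm⟩ := Nat.exists_eq_add_of_lt hq
  have hm' : Nat.card F = m + 2 := by omega
  rw [hm'] at h ⊢
  have hpos : 0 < (m + 2) * (m + 2 - 1) := Nat.mul_pos (by omega) (by omega)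
  refine Nat.eq_of_mul_eq_mul_right hpos (h.symm.trans ?_)
  have : (m + 2) ^ 4 = ((m + 2) ^ 2 + (m + 2) + 1) * ((m + 2) * (m + 1)) + (m + 2) := by ring
  rw [this, Nat.add_sub_cancel]
  rfl

theorem ncard_properIdempotents (F : Type*) [Field F] [Finite F] :
    (properIdempotents F).ncard = Nat.card F ^ 2 + Nat.card F := by
  -- Proper idempotents have trace `1` and determinant `0`; the two pieces are given by a nonzero or
  -- zero upper right entry.
  have heq : properIdempotents F
      = (fun ab : F × F => !![ab.1, ab.2; ab.1 * (1 - ab.1) / ab.2, 1 - ab.1]) ''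
          (Set.univ ×ˢ {b | b ≠ 0})
        ∪ (fun ac : F × F => !![ac.1, 0; ac.2, 1 - ac.1]) '' ({0, 1} ×ˢ Set.univ) := by
    ext e
    constructor
    · intro he
      have hdet := det_eq_zero_of_mem_properIdempotents he
      have hsq := mul_self_eq_smul_of_det_eq_zero hdet
      rw [he.1] at hsq
      have htr : e 0 0 + e 1 1 = 1 := by
        have : (1 - (e 0 0 + e 1 1)) • e = 0 := by rw [sub_smul, one_smul, ← hsq, sub_self]
        exact (sub_eq_zero.1 ((smul_eq_zero.1 this).resolve_right he.2.1)).symm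
      have h11 : e 1 1 = 1 - e 0 0 := by rw [← htr]; ring
      rw [Matrix.det_fin_two, h11] at hdet
      by_cases hb : e 0 1 = 0
      · right
        refine ⟨(e 0 0, e 1 0), ⟨?_, trivial⟩, ?_⟩
        · rw [hb, zero_mul, sub_zero, mul_eq_zero, sub_eq_zero] at hdet
          exact hdet.imp id Eq.symm
        · ext i j
          fin_cases i <;> fin_cases j <;> simp [hb, h11]
      · left
        refine ⟨(e 0 0, e 0 1), ⟨trivial, hb⟩, ?_⟩
        have : e 1 0 = e 0 0 * (1 - e 0 0) / e 0 1 := by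
          field_simp
          linear_combination -hdet
        ext i j
        fin_cases i <;> fin_cases j <;> simp [h11, this]
    · rintro (⟨⟨x, b⟩, ⟨-, hb⟩, rfl⟩ | ⟨⟨x, c⟩, ⟨hx, -⟩, rfl⟩)
      · have hb : b ≠ 0 := hb
        refine ⟨?_, fun h => hb ?_, fun h => hb ?_⟩
        · ext i j
          fin_cases i <;> fin_cases j <;> simp [Matrix.mul_apply, Fin.sum_univ_two] <;>
            field_simp <;> ring
        · simpa using congrFun (congrFun h 0) 1
        · simpa using congrFun (congrFun h 0) 1
      · have hx' : x * x = x := by rcases hx with rfl | rfl <;> simp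
        refine ⟨?_, fun h => ?_, fun h => ?_⟩
        · ext i j
          fin_cases i <;> fin_cases j <;> simp [Matrix.mul_apply, Fin.sum_univ_two, hx']
          · ring
          · linear_combination hx'
        · have h0 := congrFun (congrFun h 0) 0
          have h1 := congrFun (congrFun h 1) 1
          simp only [of_apply, cons_val', cons_val_zero, cons_val_one, cons_val_fin_one,
            Matrix.zero_apply] at h0 h1
          rw [h0, sub_zero] at h1
          exact one_ne_zero h1
        · have h0 := congrFun (congrFun h 0) 0
          have h1 := congrFun (congrFun h 1) 1
          simp only [of_apply, cons_val', cons_val_zero, cons_val_one, cons_val_fin_one,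
            one_apply_eq] at h0 h1
          rw [h0, sub_self] at h1
          exact zero_ne_one h1
  have hq : 1 < Nat.card F := Finite.one_lt_card
  rw [heq, Set.ncard_union_eq, Set.ncard_image_of_injective, Set.ncard_image_of_injective,
    Set.ncard_prod, Set.ncard_prod, Set.ncard_univ, ncard_setOf_ne_zero, Set.ncard_pair zero_ne_one]
  · obtain ⟨m, hm⟩ := Nat.exists_eq_add_of_lt hq
    have hm' : Nat.card F = m + 2 := by omega
    rw [hm', show m + 2 - 1 = m + 1 from rfl]
    ring
  · rintro ⟨x, y⟩ ⟨z, w⟩ h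
    have h0 := congrFun (congrFun h 0) 0
    have h1 := congrFun (congrFun h 1) 0
    simp at h0 h1
    rw [h0, h1]
  · rintro ⟨x, y⟩ ⟨z, w⟩ h
    have h0 := congrFun (congrFun h 0) 0
    have h1 := congrFun (congrFun h 0) 1
    simp at h0 h1
    rw [h0, h1]
  · refine Set.disjoint_left.2 ?_
    rintro _ ⟨⟨x, b⟩, ⟨-, hb⟩, rfl⟩ ⟨⟨z, w⟩, -, h⟩
    have h1 := congrFun (congrFun h 0) 1
    simp at h1
    exact hb h1.symm

theorem ncard_nonzeroNilpotents (F : Type*) [Field F] [Finite F] :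
    (nonzeroNilpotents F).ncard = Nat.card F ^ 2 - 1 := by
  have heq : nonzeroNilpotents F
      = (fun ab : F × F => !![ab.1, ab.2; -(ab.1 * ab.1) / ab.2, -ab.1]) ''
          (Set.univ ×ˢ {b | b ≠ 0})
        ∪ (fun c : F => !![0, 0; c, 0]) '' {c | c ≠ 0} := by
    ext e
    constructor
    · intro he
      have hdet := det_eq_zero_of_mem_nonzeroNilpotents he
      have hsq := mul_self_eq_smul_of_det_eq_zero hdet
      rw [he.1] at hsq
      have htr : e 0 0 + e 1 1 = 0 := (smul_eq_zero.1 hsq.symm).resolve_right he.2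
      have h11 : e 1 1 = - e 0 0 := by linear_combination htr
      rw [Matrix.det_fin_two, h11] at hdet
      by_cases hb : e 0 1 = 0
      · right
        have h00 : e 0 0 = 0 := mul_self_eq_zero.1 (by rw [hb] at hdet; linear_combination -hdet)
        refine ⟨e 1 0, fun hc => he.2 ?_, ?_⟩
        · ext i j
          fin_cases i <;> fin_cases j <;> simp [hb, h11, h00, hc]
        · ext i j
          fin_cases i <;> fin_cases j <;> simp [hb, h11, h00]
      · left
        refine ⟨(e 0 0, e 0 1), ⟨trivial, hb⟩, ?_⟩
        have : e 1 0 = -(e 0 0 * e 0 0) / e 0 1 := by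
          field_simp
          linear_combination -hdet
        ext i j
        fin_cases i <;> fin_cases j <;> simp [h11, this]
    · rintro (⟨⟨x, b⟩, ⟨-, hb⟩, rfl⟩ | ⟨c, hc, rfl⟩)
      · have hb : b ≠ 0 := hb
        refine ⟨?_, fun h => hb ?_⟩
        · ext i j
          fin_cases i <;> fin_cases j <;> simp [Matrix.mul_apply, Fin.sum_univ_two] <;>
            field_simp <;> ring
        · simpa using congrFun (congrFun h 0) 1
      · refine ⟨?_, fun h => hc ?_⟩
        · ext i j
          fin_cases i <;> fin_cases j <;> simp [Matrix.mul_apply, Fin.sum_univ_two]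
        · simpa using congrFun (congrFun h 1) 0
  have hq : 1 < Nat.card F := Finite.one_lt_card
  rw [heq, Set.ncard_union_eq, Set.ncard_image_of_injective, Set.ncard_image_of_injective,
    Set.ncard_prod, Set.ncard_univ, ncard_setOf_ne_zero]
  · obtain ⟨m, hm⟩ := Nat.exists_eq_add_of_lt hq
    have hm' : Nat.card F = m + 2 := by omega
    rw [hm', show m + 2 - 1 = m + 1 from rfl,
      show (m + 2) ^ 2 = (m + 2) * (m + 1) + (m + 1) + 1 by ring, Nat.add_sub_cancel]
  · intro x z h
    simpa using congrFun (congrFun h 1) 0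
  · rintro ⟨x, y⟩ ⟨z, w⟩ h
    have h0 := congrFun (congrFun h 0) 0
    have h1 := congrFun (congrFun h 0) 1
    simp at h0 h1
    rw [h0, h1]
  · refine Set.disjoint_left.2 ?_
    rintro _ ⟨⟨x, b⟩, ⟨-, hb⟩, rfl⟩ ⟨z, -, h⟩
    have h1 := congrFun (congrFun h 0) 1
    simp at h1
    exact hb h1.symm

theorem mem_properIdempotents_of_smul {e : Matrix (Fin 2) (Fin 2) F}
    (he : e ∈ properIdempotents F) {x y : F} :
    x • 1 + y • e ∈ properIdempotents F ↔ x = 0 ∧ y = 1 ∨ x = 1 ∧ y = -1 := by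
  have hns := properIdempotents_subset he
  constructor
  · intro h
    have hy : y ≠ 0 := (smul_one_add_smul_mem_nonscalar_iff hns).1 (properIdempotents_subset h)
    have h1 : (x * x) • (1 : Matrix (Fin 2) (Fin 2) F) + (2 * x * y + y * y) • e
        = x • 1 + y • e := by
      conv_rhs => rw [← h.1]
      simp only [mul_add, add_mul, smul_mul_smul_comm, one_mul, mul_one, he.1]
      module
    obtain ⟨h2, h3⟩ := smul_one_add_smul_inj hns h1
    have h4 : 2 * x + y = 1 := mul_right_cancel₀ hy (by linear_combination h3)
    rcases eq_or_ne x 0 with rfl | hx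
    · exact Or.inl ⟨rfl, by linear_combination h4⟩
    · have hx1 : x = 1 := mul_left_cancel₀ hx (by linear_combination h2)
      subst hx1
      exact Or.inr ⟨rfl, by linear_combination h4⟩
  · rintro (⟨rfl, rfl⟩ | ⟨rfl, rfl⟩)
    · simpa using he
    · rw [one_smul, neg_one_smul, ← sub_eq_add_neg]
      refine ⟨?_, fun h => he.2.2 (sub_eq_zero.1 h).symm, fun h => he.2.1 ?_⟩
      · simp [mul_sub, sub_mul, he.1]
      · simpa using h

/-- The only proper idempotents in `F + F e` are `e` and `1 - e`, which differ in every
characteristic because `1` and `e` are independent. -/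
theorem two_mul_ncard_centralizers_properIdempotents (F : Type*) [Field F] [Finite F] :
    ((fun a : Matrix (Fin 2) (Fin 2) F => Set.centralizer {a}) '' properIdempotents F).ncard * 2
      = Nat.card F ^ 2 + Nat.card F := by
  rw [← ncard_properIdempotents F]
  refine (Set.ncard_eq_ncard_image_mul _ _ 2 fun e he => ?_).symm
  have hns := properIdempotents_subset he
  have : {b | b ∈ properIdempotents F ∧ Set.centralizer {b} = Set.centralizer {e}}
      = {e, 1 - e} := by
    ext b
    constructor
    · rintro ⟨hb, h⟩
      have hb' : b ∈ Set.centralizer {e} := h ▸ mem_centralizer_singleton.2 rfl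
      obtain ⟨x, y, rfl⟩ := (mem_centralizer_iff_exists hns).1 hb'
      rcases (mem_properIdempotents_of_smul he).1 hb with ⟨rfl, rfl⟩ | ⟨rfl, rfl⟩
      · left; simp
      · right; simp [sub_eq_add_neg]
    · rintro (rfl | rfl)
      · exact ⟨he, rfl⟩
      · have h1 := (mem_properIdempotents_of_smul he (x := 1) (y := -1)).2 (Or.inr ⟨rfl, rfl⟩)
        have h2 := centralizer_smul_one_add_smul hns (x := 1) (y := -1) (by simp)
        rw [one_smul, neg_one_smul, ← sub_eq_add_neg] at h1 h2
        exact ⟨h1, h2⟩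
  rw [this, Set.ncard_pair]
  intro h
  have := (smul_one_add_smul_inj hns (x := 0) (y := 1) (x' := 1) (y' := -1) (by
    rw [one_smul, one_smul, zero_smul, zero_add, neg_one_smul, ← sub_eq_add_neg]; exact h)).1
  exact zero_ne_one this

/-- The nonzero nilpotents in `F + F N` are the `q - 1` nonzero multiples of `N`, and `q ^ 2 - 1 =
(q + 1) (q - 1)`. -/
theorem ncard_centralizers_nonzeroNilpotents (F : Type*) [Field F] [Finite F] :
    ((fun a : Matrix (Fin 2) (Fin 2) F => Set.centralizer {a}) '' nonzeroNilpotents F).ncard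
      = Nat.card F + 1 := by
  have h := Set.ncard_eq_ncard_image_mul
    (fun a : Matrix (Fin 2) (Fin 2) F => Set.centralizer {a}) (nonzeroNilpotents F)
    (Nat.card F - 1) (fun N hN => by
      have hns := nonzeroNilpotents_subset hN
      have : {b | b ∈ nonzeroNilpotents F ∧ Set.centralizer {b} = Set.centralizer {N}}
          = (fun y : F => y • N) '' {y | y ≠ 0} := by
        ext b
        constructor
        · rintro ⟨hb, h⟩
          have hb' : b ∈ Set.centralizer {N} := h ▸ mem_centralizer_singleton.2 rfl
          obtain ⟨x, y, rfl⟩ := (mem_centralizer_iff_exists hns).1 hb'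
          have hy := (smul_one_add_smul_mem_nonscalar_iff hns).1 (nonzeroNilpotents_subset hb)
          have h1 : (x * x) • (1 : Matrix (Fin 2) (Fin 2) F) + (2 * x * y) • N
              = (0 : F) • 1 + (0 : F) • N := by
            rw [zero_smul, zero_smul, add_zero, ← hb.1]
            simp only [mul_add, add_mul, smul_mul_smul_comm, one_mul, mul_one, hN.1]
            module
          have hx := mul_self_eq_zero.1 (smul_one_add_smul_inj hns h1).1
          exact ⟨y, hy, by simp [hx]⟩
        · rintro ⟨y, hy, rfl⟩
          refine ⟨⟨by simp [hN.1], smul_ne_zero hy hN.2⟩, ?_⟩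
          have := centralizer_smul_one_add_smul hns (x := 0) hy
          rwa [zero_smul, zero_add] at this
      rw [this, Set.ncard_image_of_injective _ (smul_left_injective F hN.2), ncard_setOf_ne_zero])
  have hq : 1 < Nat.card F := Finite.one_lt_card
  rw [ncard_nonzeroNilpotents] at h
  obtain ⟨m, hm⟩ := Nat.exists_eq_add_of_lt hq
  have hm' : Nat.card F = m + 2 := by omega
  rw [hm'] at h ⊢
  refine Nat.eq_of_mul_eq_mul_right (Nat.succ_pos m) (h.symm.trans ?_)
  rw [show (m + 2) ^ 2 = (m + 2 + 1) * (m + 1) + 1 by ring, Nat.add_sub_cancel]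

theorem two_mul_ncard_centralizers_withoutEigenvalues (F : Type*) [Field F] [Finite F] :
    ((fun a : Matrix (Fin 2) (Fin 2) F => Set.centralizer {a}) '' withoutEigenvalues F).ncard * 2
      = Nat.card F ^ 2 - Nat.card F := by
  have h := ncard_centralizers_nonscalar F
  rw [image_centralizer_nonscalar, Set.ncard_union_eq disjoint_centralizer_withoutEigenvalues,
    Set.ncard_union_eq disjoint_centralizer_idempotent_nilpotent,
    ncard_centralizers_nonzeroNilpotents] at h
  have h2 := two_mul_ncard_centralizers_properIdempotents F
  omega

end CountingCentralizers

/-! ### Classes belonging to one centralizer -/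

section MatrixClasses

open Matrix

variable {F : Type*} [Field F] {a : Matrix (Fin 2) (Fin 2) F}

/-- An injective homomorphism preserves generated subrings, so the classes can be counted in an
abstract model `S` of the centralizer. -/
theorem ncard_image_closure_of_hom {S : Type*} [CommRing S]
    (f : S →+* Matrix (Fin 2) (Fin 2) F) (hf : Function.Injective f) (ha : a ∈ nonscalar F)
    (hr : Set.range f = Set.centralizer {a}) :
    ((fun b : Matrix (Fin 2) (Fin 2) F =>
      (NonUnitalSubring.closure {b} : Set (Matrix (Fin 2) (Fin 2) F))) ''
      {b | Set.centralizer {b} = Set.centralizer {a}}).ncard =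
    ((fun s : S => (NonUnitalSubring.closure {s} : Set S)) '' {s | f s ∈ nonscalar F}).ncard := by
  have h : {b | Set.centralizer {b} = Set.centralizer {a}} = f '' {s | f s ∈ nonscalar F} := by
    rw [setOf_centralizer_eq ha, ← hr]
    ext b
    constructor
    · rintro ⟨hb, s, rfl⟩
      exact ⟨s, hb, rfl⟩
    · rintro ⟨s, hs, rfl⟩
      exact ⟨hs, s, rfl⟩
  rw [h, Set.image_image]
  refine Set.ncard_image_eq_of_forall_eq_iff _ _ fun s _ t _ => ?_
  have : ∀ s, (NonUnitalSubring.closure {f s} : Set (Matrix (Fin 2) (Fin 2) F))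
      = f '' (NonUnitalSubring.closure {s} : Set S) :=
    NonUnitalSubring.coe_closure_singleton_map (f : S →ₙ+* Matrix (Fin 2) (Fin 2) F)
  rw [this, this, (Set.image_injective.2 hf).eq_iff]

/-- The embedding of `F × F` attached to an idempotent. -/
def idempotentHom {e : Matrix (Fin 2) (Fin 2) F} (he : e * e = e) :
    F × F →+* Matrix (Fin 2) (Fin 2) F where
  -- This is `s.1 • e + s.2 • (1 - e)` in the basis `1, e`; the image is nonscalar exactly when `s.1
  -- ≠ s.2`.
  toFun s := s.2 • 1 + (s.1 - s.2) • e
  map_one' := by simp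
  map_mul' s t := by
    simp only [mul_add, add_mul, smul_mul_smul_comm, one_mul, mul_one, he, Prod.fst_mul,
      Prod.snd_mul]
    module
  map_zero' := by simp
  map_add' s t := by
    simp only [Prod.fst_add, Prod.snd_add]
    module

open DualNumber TrivSqZeroExt in
/-- The embedding of the dual numbers attached to a matrix of square zero. -/
def nilpotentHom {N : Matrix (Fin 2) (Fin 2) F} (hN : N * N = 0) :
    F[ε] →+* Matrix (Fin 2) (Fin 2) F where
  toFun s := s.fst • 1 + s.snd • N
  map_one' := by simp
  map_mul' s t := by
    simp only [mul_add, add_mul, smul_mul_smul_comm, one_mul, mul_one, hN, fst_mul,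
      DualNumber.snd_mul]
    module
  map_zero' := by simp
  map_add' s t := by
    simp only [fst_add, snd_add]
    module

variable (p : ℕ) [Fact p.Prime] [Finite F] [CharP F p]

theorem ncard_classes_idempotent {n : ℕ} (hn : 0 < n) (hF : Nat.card F = p ^ n)
    {e : Matrix (Fin 2) (Fin 2) F} (he : e ∈ properIdempotents F) :
    ((fun b : Matrix (Fin 2) (Fin 2) F =>
      (NonUnitalSubring.closure {b} : Set (Matrix (Fin 2) (Fin 2) F))) ''
      {b | Set.centralizer {b} = Set.centralizer {e}}).ncard = CompressedCommuting.a' p n := by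
  have hns := properIdempotents_subset he
  rw [ncard_image_closure_of_hom (idempotentHom he.1) ?_ hns ?_,
    ← ncard_image_closure_split p hn hF]
  · congr 2
    ext s
    exact (smul_one_add_smul_mem_nonscalar_iff hns).trans sub_ne_zero
  · intro s t h
    obtain ⟨h1, h2⟩ := smul_one_add_smul_inj hns h
    exact Prod.ext (by linear_combination h1 + h2) h1
  · ext b
    rw [mem_centralizer_iff_exists hns]
    constructor
    · rintro ⟨s, rfl⟩
      exact ⟨_, _, rfl⟩
    · rintro ⟨x, y, rfl⟩
      exact ⟨(x + y, x), by simp [idempotentHom]⟩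

open DualNumber TrivSqZeroExt in
theorem ncard_classes_nilpotent {n : ℕ} (hn : 0 < n) (hF : Nat.card F = p ^ n)
    {N : Matrix (Fin 2) (Fin 2) F} (hN : N ∈ nonzeroNilpotents F) :
    ((fun b : Matrix (Fin 2) (Fin 2) F =>
      (NonUnitalSubring.closure {b} : Set (Matrix (Fin 2) (Fin 2) F))) ''
      {b | Set.centralizer {b} = Set.centralizer {N}}).ncard = CompressedCommuting.b' p n := by
  have hns := nonzeroNilpotents_subset hN
  rw [ncard_image_closure_of_hom (nilpotentHom hN.1) ?_ hns ?_,
    ← ncard_image_closure_dualNumber p hn hF]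
  · congr 2
    ext s
    exact smul_one_add_smul_mem_nonscalar_iff hns
  · intro s t h
    obtain ⟨h1, h2⟩ := smul_one_add_smul_inj hns h
    exact TrivSqZeroExt.ext h1 h2
  · ext b
    rw [mem_centralizer_iff_exists hns]
    constructor
    · rintro ⟨s, rfl⟩
      exact ⟨_, _, rfl⟩
    · rintro ⟨x, y, rfl⟩
      exact ⟨inl x + inr y, by simp [nilpotentHom]⟩

open Polynomial in
theorem ncard_classes_withoutEigenvalues {n : ℕ} (hn : 0 < n) (hF : Nat.card F = p ^ n)
    (ha : a ∈ withoutEigenvalues F) :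
    ((fun b : Matrix (Fin 2) (Fin 2) F =>
      (NonUnitalSubring.closure {b} : Set (Matrix (Fin 2) (Fin 2) F))) ''
      {b | Set.centralizer {b} = Set.centralizer {a}}).ncard = CompressedCommuting.c n := by
  have hdeg : a.charpoly.natDegree = 2 := by
    rw [Matrix.charpoly_natDegree_eq_dim, Fintype.card_fin]
  -- A quadratic without roots is irreducible, so `F[X]` modulo it is a field with `q ^ 2` elements
  -- that evaluation at `a` embeds in the matrices.
  have hirr : Irreducible a.charpoly := by
    refine irreducible_of_degree_le_three_of_not_isRoot (by rw [hdeg]; decide) fun r hr => ?_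
    rw [IsRoot, Matrix.eval_charpoly] at hr
    refine ha.2 r ?_
    have : a - r • 1 = -(Matrix.scalar (Fin 2) r - a) := by
      rw [neg_sub, Matrix.scalar_apply, Matrix.smul_one_eq_diagonal]
    rw [this, Matrix.det_neg, hr, mul_zero]
  have : Fact (Irreducible a.charpoly) := ⟨hirr⟩
  let f : AdjoinRoot a.charpoly →+* Matrix (Fin 2) (Fin 2) F :=
    Ideal.Quotient.lift (Ideal.span {a.charpoly}) (aeval a).toRingHom (by
      intro g hg
      obtain ⟨h, rfl⟩ := Ideal.mem_span_singleton.1 hg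
      simp [Matrix.aeval_self_charpoly])
  have hfmk : ∀ g : F[X], f (AdjoinRoot.mk a.charpoly g) = aeval a g := fun g => rfl
  have hinj : Function.Injective f := f.injective
  have hof : ∀ r : F, f (AdjoinRoot.of a.charpoly r) = r • 1 := by
    intro r
    have := hfmk (C r)
    rw [aeval_C, AdjoinRoot.mk_C] at this
    rw [this, Algebra.algebraMap_eq_smul_one]
  have hfin : Module.finrank F (AdjoinRoot a.charpoly) = 2 := by
    rw [(AdjoinRoot.powerBasis hirr.ne_zero).finrank, AdjoinRoot.powerBasis_dim, hdeg]
  have hmf : Module.Finite F (AdjoinRoot a.charpoly) :=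
    (AdjoinRoot.powerBasis hirr.ne_zero).finite
  have hfinite : Finite (AdjoinRoot a.charpoly) := Module.finite_of_finite F
  have hcard : Nat.card (AdjoinRoot a.charpoly) = p ^ (2 * n) := by
    rw [Module.natCard_eq_pow_finrank (K := F), hfin, hF, ← pow_mul, mul_comm]
  have hchar : CharP (AdjoinRoot a.charpoly) p :=
    charP_of_injective_algebraMap (algebraMap F (AdjoinRoot a.charpoly)).injective p
  rw [ncard_image_closure_of_hom f hinj ha.1 ?_, CompressedCommuting.c, CompressedCommuting.d,
    CompressedCommuting.d, ← ncard_image_closure_field p hn hcard]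
  · congr 2
    -- The scalars are all of the fixed field of `Frob ^ n`: they lie in it and already number `p ^
    -- n`.
    have hrange : Set.range (AdjoinRoot.of a.charpoly)
        = frobFixed p (AdjoinRoot a.charpoly) n := by
      refine Set.eq_of_subset_of_ncard_le ?_ ?_
      · rintro _ ⟨r, rfl⟩
        rw [frobFixed, Set.mem_ofPred_eq, ← map_pow, pow_prime_pow_eq_self p hF]
      · rw [← Set.image_univ, Set.ncard_image_of_injective _ (AdjoinRoot.of a.charpoly).injective,
          Set.ncard_univ, hF]
        exact ncard_frobFixed_le p hn
    ext s
    have hs : s ^ p ^ n = s ↔ s ∈ Set.range (AdjoinRoot.of a.charpoly) := by rw [hrange]; rfl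
    rw [Set.mem_ofPred_eq, Set.mem_ofPred_eq, ne_eq, hs]
    constructor
    · rintro h ⟨r, rfl⟩
      exact h r (hof r)
    · intro h r hr
      exact h ⟨r, hinj ((hof r).trans hr.symm)⟩
  · ext b
    constructor
    · rintro ⟨s, rfl⟩
      obtain ⟨g, rfl⟩ := AdjoinRoot.mk_surjective s
      rw [hfmk, mem_centralizer_singleton]
      have h := congrArg (aeval a) (mul_comm (X : F[X]) g)
      rwa [map_mul, map_mul, aeval_X] at h
    · intro hb
      obtain ⟨x, y, rfl⟩ := (mem_centralizer_iff_exists ha.1).1 hb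
      refine ⟨AdjoinRoot.mk _ (C x + C y * X), ?_⟩
      rw [hfmk]
      simp [Algebra.algebraMap_eq_smul_one]

theorem ncard_classes_scalar {n : ℕ} (hn : 0 < n) (hF : Nat.card F = p ^ n) :
    ((fun b : Matrix (Fin 2) (Fin 2) F =>
      (NonUnitalSubring.closure {b} : Set (Matrix (Fin 2) (Fin 2) F))) ''
      {b | Set.centralizer {b} = Set.univ}).ncard = CompressedCommuting.d n + 1 := by
  rw [CompressedCommuting.d, ← ncard_range_closure_field p hn hF, ← Set.image_univ]
  let f : F →+* Matrix (Fin 2) (Fin 2) F := algebraMap F _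
  have h : {b : Matrix (Fin 2) (Fin 2) F | Set.centralizer {b} = Set.univ} = f '' Set.univ := by
    ext b
    rw [Set.mem_ofPred_eq, centralizer_eq_univ_iff, Set.image_univ]
    simp [nonscalar, f, Algebra.algebraMap_eq_smul_one, eq_comm]
  rw [h, Set.image_image]
  refine Set.ncard_image_eq_of_forall_eq_iff _ _ fun s _ t _ => ?_
  have : ∀ s, (NonUnitalSubring.closure {f s} : Set (Matrix (Fin 2) (Fin 2) F))
      = f '' (NonUnitalSubring.closure {s} : Set F) :=
    NonUnitalSubring.coe_closure_singleton_map (f : F →ₙ+* Matrix (Fin 2) (Fin 2) F)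
  rw [this, this, (Set.image_injective.2 f.injective).eq_iff]

end MatrixClasses

/-! ### Assembling the graph from a labelling -/

namespace LoopGraph

variable {V W W₁ W₂ τ : Type*}

/-- The subgraph induced on the vertices satisfying a predicate. -/
def induce (G : LoopGraph V) (P : V → Prop) : LoopGraph {v // P v} where
  Adj u v := G.Adj u v
  symm _ _ := G.symm _ _

theorem nonempty_iso_completeLoop [Finite V] (G : LoopGraph V) (hG : ∀ u v, G.Adj u v) {m : ℕ}
    (hm : Nat.card V = m) : Nonempty (G.Iso (completeLoop m)) :=
  ⟨⟨Finite.equivFinOfCardEq hm, fun {u v} => ⟨fun _ => hG u v, fun _ => trivial⟩⟩⟩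

theorem nonempty_iso_disjointUnion (G : LoopGraph V) (P : V → Prop) {H₁ : LoopGraph W₁}
    {H₂ : LoopGraph W₂} (h₁ : Nonempty ((G.induce P).Iso H₁))
    (h₂ : Nonempty ((G.induce fun v => ¬ P v).Iso H₂))
    (h : ∀ u v, P u → ¬ P v → ¬ G.Adj u v) : Nonempty (G.Iso (H₁.disjointUnion H₂)) := by
  classical
  obtain ⟨e₁⟩ := h₁
  obtain ⟨e₂⟩ := h₂
  refine ⟨RelIso.symm ⟨(Equiv.sumCongr e₁.symm.toEquiv e₂.symm.toEquiv).trans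
    (Equiv.sumCompl P), ?_⟩⟩
  rintro (a | a) (b | b)
  · exact e₁.symm.map_rel_iff (a := a) (b := b)
  · exact iff_of_false (h _ _ (e₁.symm a).2 (e₂.symm b).2) id
  · exact iff_of_false (fun hab => h _ _ (e₁.symm b).2 (e₂.symm a).2 (G.symm _ _ hab)) id
  · exact e₂.symm.map_rel_iff (a := a) (b := b)

theorem nonempty_iso_join (G : LoopGraph V) (P : V → Prop) {H₁ : LoopGraph W₁}
    {H₂ : LoopGraph W₂} (h₁ : Nonempty ((G.induce P).Iso H₁))
    (h₂ : Nonempty ((G.induce fun v => ¬ P v).Iso H₂))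
    (h : ∀ u v, P u → ¬ P v → G.Adj u v) : Nonempty (G.Iso (H₁.join H₂)) := by
  classical
  obtain ⟨e₁⟩ := h₁
  obtain ⟨e₂⟩ := h₂
  refine ⟨RelIso.symm ⟨(Equiv.sumCongr e₁.symm.toEquiv e₂.symm.toEquiv).trans
    (Equiv.sumCompl P), ?_⟩⟩
  rintro (a | a) (b | b)
  · exact e₁.symm.map_rel_iff (a := a) (b := b)
  · exact iff_of_true (h _ _ (e₁.symm a).2 (e₂.symm b).2) trivial
  · exact iff_of_true (G.symm _ _ (h _ _ (e₁.symm b).2 (e₂.symm a).2)) trivial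
  · exact e₂.symm.map_rel_iff (a := a) (b := b)

theorem nonempty_iso_copies [Finite V] [Finite τ] (G : LoopGraph V) (f : V → τ) (T : Set τ)
    (hf : ∀ v, f v ∈ T) (hadj : ∀ u v, G.Adj u v ↔ f u = f v) {t m : ℕ} (ht : T.ncard = t)
    (hm : ∀ A ∈ T, Nat.card {v // f v = A} = m) :
    Nonempty (G.Iso (copies t (completeLoop m))) := by
  let e : T ≃ Fin t := Finite.equivFinOfCardEq ht
  let f' : V → T := fun v => ⟨f v, hf v⟩
  have hm' : ∀ A : T, Nat.card {v // f' v = A} = m := fun A => by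
    rw [← hm A A.2]
    exact Nat.card_congr (Equiv.subtypeEquivRight fun v => Subtype.ext_iff)
  let g : ∀ A : T, {v // f' v = A} ≃ Fin m := fun A => Finite.equivFinOfCardEq (hm' A)
  refine ⟨⟨((Equiv.sigmaFiberEquiv f').symm.trans (Equiv.sigmaCongrRight g)).trans
    ((Equiv.sigmaEquivProd T (Fin m)).trans (Equiv.prodCongr e (Equiv.refl _))), ?_⟩⟩
  intro u v
  rw [hadj]
  have : e (f' u) = e (f' v) ∧ True ↔ f u = f v := by
    rw [and_true, e.injective.eq_iff, Subtype.ext_iff]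
  exact this

/-- The pieces of the graph are nested subtypes; a fibre contained in a piece keeps its size there.
-/
theorem card_fiber_comp (f : V → τ) (i : W → V) (hi : Function.Injective i) (A : τ)
    (h : ∀ v, f v = A → v ∈ Set.range i) :
    Nat.card {w // f (i w) = A} = Nat.card {v // f v = A} := by
  refine Nat.card_eq_of_bijective (fun w => ⟨i w.1, w.2⟩) ⟨?_, ?_⟩
  · rintro ⟨w, hw⟩ ⟨w', hw'⟩ h
    exact Subtype.ext (hi (congrArg Subtype.val h))
  · rintro ⟨v, hv⟩
    obtain ⟨w, rfl⟩ := h v hv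
    exact ⟨⟨w, hv⟩, rfl⟩

/-- A graph whose adjacency is governed by a labelling with one universal label. -/
theorem nonempty_iso_of_labelling [Finite V] [Finite τ] (G : LoopGraph V) (f : V → τ) (z : τ)
    (T₁ T₂ T₃ : Set τ) (hadj : ∀ u v, G.Adj u v ↔ f u = z ∨ f v = z ∨ f u = f v)
    (hz : z ∉ T₁ ∪ T₂ ∪ T₃) (hcover : ∀ v, f v = z ∨ f v ∈ T₁ ∪ T₂ ∪ T₃)
    (h₁₂ : Disjoint T₁ T₂) (h₃ : Disjoint (T₁ ∪ T₂) T₃) {m t₁ t₂ t₃ m₁ m₂ m₃ : ℕ}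
    (hm : Nat.card {v // f v = z} = m) (ht₁ : T₁.ncard = t₁) (ht₂ : T₂.ncard = t₂)
    (ht₃ : T₃.ncard = t₃) (hm₁ : ∀ A ∈ T₁, Nat.card {v // f v = A} = m₁)
    (hm₂ : ∀ A ∈ T₂, Nat.card {v // f v = A} = m₂)
    (hm₃ : ∀ A ∈ T₃, Nat.card {v // f v = A} = m₃) :
    Nonempty (G.Iso (join (completeLoop m) (disjointUnion (disjointUnion
      (copies t₁ (completeLoop m₁)) (copies t₂ (completeLoop m₂)))
      (copies t₃ (completeLoop m₃))))) := by
  have hne : ∀ {A}, A ∈ T₁ ∪ T₂ ∪ T₃ → A ≠ z := fun hA h => hz (h ▸ hA)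
  have hadj' : ∀ u v, f u ≠ z → f v ≠ z → (G.Adj u v ↔ f u = f v) := by
    intro u v hu hv
    simp [hadj, hu, hv]
  refine nonempty_iso_join G (fun v => f v = z)
    (nonempty_iso_completeLoop _ (fun u _ => (hadj u.1 _).2 (Or.inl u.2)) hm)
    (nonempty_iso_disjointUnion _ (fun v => f v.1 ∈ T₁ ∪ T₂)
      (nonempty_iso_disjointUnion _ (fun v => f v.1.1 ∈ T₁) ?_ ?_ ?_) ?_ ?_)
    fun u v hu _ => (hadj _ _).2 (Or.inl hu)
  · refine nonempty_iso_copies _ (fun v => f v.1.1.1) T₁ (fun v => v.2)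
      (fun u v => hadj' _ _ u.1.1.2 v.1.1.2) ht₁ fun A hA => ?_
    rw [← hm₁ A hA]
    exact card_fiber_comp f (fun v => v.1.1.1) (fun u v h => Subtype.ext (Subtype.ext
      (Subtype.ext h))) A fun v hv => ⟨⟨⟨⟨v, hv ▸ hne (Or.inl (Or.inl hA))⟩,
        Or.inl (hv ▸ hA)⟩, show f v ∈ T₁ from hv ▸ hA⟩, rfl⟩
  · refine nonempty_iso_copies _ (fun v => f v.1.1.1) T₂ (fun v => v.1.2.resolve_left v.2)
      (fun u v => hadj' _ _ u.1.1.2 v.1.1.2) ht₂ fun A hA => ?_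
    rw [← hm₂ A hA]
    exact card_fiber_comp f (fun v => v.1.1.1) (fun u v h => Subtype.ext (Subtype.ext
      (Subtype.ext h))) A fun v hv => ⟨⟨⟨⟨v, hv ▸ hne (Or.inl (Or.inr hA))⟩,
        Or.inr (hv ▸ hA)⟩, show f v ∉ T₁ from fun h => Set.disjoint_left.1 h₁₂ h (hv ▸ hA)⟩, rfl⟩
  · intro u v hu hv h
    have h := (hadj' _ _ u.1.2 v.1.2).1 h
    exact hv (by rw [← h]; exact hu)
  · refine nonempty_iso_copies _ (fun v => f v.1.1) T₃
      (fun v => ((hcover v.1.1).resolve_left v.1.2).resolve_left v.2)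
      (fun u v => hadj' _ _ u.1.2 v.1.2) ht₃ fun A hA => ?_
    rw [← hm₃ A hA]
    exact card_fiber_comp f (fun v => v.1.1) (fun u v h => Subtype.ext (Subtype.ext h)) A
      fun v hv => ⟨⟨⟨v, hv ▸ hne (Or.inr hA)⟩,
        show f v ∉ T₁ ∪ T₂ from fun h => Set.disjoint_left.1 h₃ h (hv ▸ hA)⟩, rfl⟩
  · intro u v hu hv h
    have h := (hadj' _ _ u.2 v.2).1 h
    exact hv (by rw [← h]; exact hu)

end LoopGraph

/-! ### Centralizers as labels of vertices -/

namespace CompressedCommuting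

variable {R : Type*} [Ring R]

theorem centralizer_eq_of_genSetoid {a b : R} (h : genSetoid R a b) :
    Set.centralizer {a} = Set.centralizer {b} := by
  ext c
  rw [mem_centralizer_singleton, mem_centralizer_singleton]
  exact (commute_congr h ((genSetoid R).refl c)).to_iff

/-- The centralizer of a vertex of the compressed commuting graph. -/
def vertexCentralizer (v : Quotient (genSetoid R)) : Set R :=
  Quotient.lift (fun a => Set.centralizer {a}) (fun _ _ h => centralizer_eq_of_genSetoid h) v

/-- A vertex is determined by the subring it generates, so vertices may be counted as subrings. -/
theorem card_vertexCentralizer_fiber (A : Set R) :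
    Nat.card {v : Quotient (genSetoid R) // vertexCentralizer v = A}
      = ((fun b : R => (NonUnitalSubring.closure {b} : Set R)) ''
          {b | Set.centralizer {b} = A}).ncard := by
  have h : {v : Quotient (genSetoid R) | vertexCentralizer v = A}
      = (fun b : R => (Quotient.mk (genSetoid R) b)) '' {b | Set.centralizer {b} = A} := by
    ext v
    constructor
    · induction v using Quotient.inductionOn with
      | h b => exact fun hb => ⟨b, hb, rfl⟩
    · rintro ⟨b, hb, rfl⟩
      exact hb
  have h2 : Nat.card {v : Quotient (genSetoid R) // vertexCentralizer v = A}
      = {v : Quotient (genSetoid R) | vertexCentralizer v = A}.ncard := rfl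
  rw [h2, h]
  refine Set.ncard_image_eq_of_forall_eq_iff _ _ fun s _ t _ => ?_
  rw [Quotient.eq, SetLike.coe_set_eq]
  rfl

end CompressedCommuting

theorem theorem4p2 (p n : ℕ) (hp : p.Prime) (hn : 1 ≤ n)
    (F : Type*) [Field F] (hF : Nat.card F = p ^ n) :
    Nonempty (LoopGraph.Iso
      (CompressedCommuting.graph (Matrix (Fin 2) (Fin 2) F))
      (LoopGraph.join (LoopGraph.completeLoop (CompressedCommuting.d n + 1))
        (LoopGraph.disjointUnion
          (LoopGraph.disjointUnion
            (LoopGraph.copies ((p ^ (2 * n) + p ^ n) / 2)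
              (LoopGraph.completeLoop (CompressedCommuting.a' p n)))
            (LoopGraph.copies (p ^ n + 1)
              (LoopGraph.completeLoop (CompressedCommuting.b' p n))))
          (LoopGraph.copies ((p ^ (2 * n) - p ^ n) / 2)
            (LoopGraph.completeLoop (CompressedCommuting.c n)))))) := by
  have : Fact p.Prime := ⟨hp⟩
  have : Finite F := Nat.finite_of_card_ne_zero (hF ▸ pow_ne_zero _ hp.ne_zero)
  have := Fintype.ofFinite F
  have : CharP F p := charP_of_card_eq_prime_pow (f := n) (by rw [← hF, Nat.card_eq_fintype_card])
  have hq : p ^ (2 * n) = Nat.card F ^ 2 := by rw [hF, ← pow_mul, mul_comm]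
  have hcover := image_centralizer_nonscalar (F := F)
  refine LoopGraph.nonempty_iso_of_labelling _ CompressedCommuting.vertexCentralizer Set.univ
    ((fun a => Set.centralizer {a}) '' properIdempotents F)
    ((fun a => Set.centralizer {a}) '' nonzeroNilpotents F)
    ((fun a => Set.centralizer {a}) '' withoutEigenvalues F) ?_ ?_ ?_
    disjoint_centralizer_idempotent_nilpotent disjoint_centralizer_withoutEigenvalues
    ?_ ?_ ?_ ?_ ?_ ?_ ?_
  · intro u v
    induction u using Quotient.inductionOn with | h a => ?_
    induction v using Quotient.inductionOn with | h b => ?_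
    change a * b = b * a ↔ Set.centralizer {a} = Set.univ ∨ Set.centralizer {b} = Set.univ ∨
      Set.centralizer {a} = Set.centralizer {b}
    by_cases ha : a ∈ nonscalar F
    · by_cases hb : b ∈ nonscalar F
      · exact (commute_iff_centralizer_eq ha hb).trans ⟨fun h => Or.inr (Or.inr h), fun h =>
        (h.resolve_left fun h => centralizer_eq_univ_iff.1 h ha).resolve_left fun h =>
          centralizer_eq_univ_iff.1 h hb⟩
      · have h := centralizer_eq_univ_iff.2 hb
        exact iff_of_true (mem_centralizer_singleton.1 (h ▸ Set.mem_univ a)).symm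
          (Or.inr (Or.inl h))
    · have h := centralizer_eq_univ_iff.2 ha
      exact iff_of_true (mem_centralizer_singleton.1 (h ▸ Set.mem_univ b)) (Or.inl h)
  · rw [← hcover]
    rintro ⟨a, ha, h⟩
    exact centralizer_eq_univ_iff.1 h ha
  · intro v
    rw [← hcover]
    induction v using Quotient.inductionOn with | h a => ?_
    by_cases ha : a ∈ nonscalar F
    · exact Or.inr ⟨a, ha, rfl⟩
    · exact Or.inl (centralizer_eq_univ_iff.2 ha)
  · rw [CompressedCommuting.card_vertexCentralizer_fiber, ncard_classes_scalar p hn hF]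
  -- The numerator is twice a cardinality, so the division by `2` is exact.
  · rw [hq, ← hF, ← two_mul_ncard_centralizers_properIdempotents F, Nat.mul_div_cancel _ two_pos]
  · rw [ncard_centralizers_nonzeroNilpotents, hF]
  · rw [hq, ← hF, ← two_mul_ncard_centralizers_withoutEigenvalues F,
      Nat.mul_div_cancel _ two_pos]
  · rintro _ ⟨e, he, rfl⟩
    rw [CompressedCommuting.card_vertexCentralizer_fiber, ncard_classes_idempotent p hn hF he]
  · rintro _ ⟨N, hN, rfl⟩
    rw [CompressedCommuting.card_vertexCentralizer_fiber, ncard_classes_nilpotent p hn hF hN]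
  · rintro _ ⟨a, ha, rfl⟩
    rw [CompressedCommuting.card_vertexCentralizer_fiber,
      ncard_classes_withoutEigenvalues p hn hF ha]
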